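/- **Setting.** A seller owns one indivisible good. Seller types $x\in X=\{1,\dots,\bar x\}$ and buyer types $y\in Y=\{1,\dots,\bar y\}$ are independent, with full-support priors $p_1,p_2$. The valuation of trader $i$ (seller $i=1$, buyer $i=2$) is $v_i^1(x)+v_i^2(y)\ge 0$, where $v_1^1,v_2^2$ are strictly increasing and $v_1^2,v_2^1$ are weakly increasing. If the good is transferred with probability $q\in[0,1]$ for a payment $t\in\mathbb R$, the seller gets $t+(v_1^1(x)+v_1^2(y))(1-q)$ and the buyer gets $(v_2^1(x)+v_2^2(y))q-t$. An *allocation* is a map $g=(q,t):X\times Y\to[0,1]\times\mathbb R$. Put $$U_1^g(\hat x\mid x)=\sum_{y}p_2(y)\bigl[t(\hat x,y)+(v_1^1(x)+v_1^2(y))(1-q(\hat x,y))\bigr],\qquad U_1^g(x)=U_1^g(x\mid x).$$ **RSW allocation.** An allocation is *safe* if $U_1^g(x)\ge U_1^g(\hat x\mid x)$ for all $x,\hat x$, and, for all $x,y,\hat y$, $(v_2^1(x)+v_2^2(y))q(x,y)-t(x,y)\ge (v_2^1(x)+v_2^2(y))q(x,\hat y)-t(x,\hat y)$ and $(v_2^1(x)+v_2^2(y))q(x,y)-t(x,y)\ge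 0$. An *RSW allocation* is a safe allocation that maximizes $U_1^g(x)$ over all safe allocations $g$ simultaneously for every $x\in X$; its payoff vector $U_1^{g^*}\in\mathbb R^X$ is the *RSW payoff vector*. **Game.** A *mechanism* $G=\langle S_1,S_2,q,t\rangle$ consists of finite nonempty action sets and an outcome function $(q,t):S_1\times S_2\to[0,1]\times\mathbb R$ (an inactive player has a single action); $\mathcal G$ is the set of all mechanisms, with some $\sigma$-algebra. After types are drawn, the seller offers some $G\in\mathcal G$; the buyer rejects, giving $(0,0)$, or accepts, and then both simultaneously choose actions, giving $(q(s_1,s_2),t(s_1,s_2))$. Given $G$ and a buyer belief $\pi_1\in\Delta(X)$, a *sequential equilibrium of the continuation game* consists of acceptance probabilities $\gamma_2(y)$, mixed actions $\sigma_1(\cdot\mid x),\sigma_2(\cdot\mid y)$, and a seller belief $\pi_2\in\Delta(Y)$ after acceptance, such that $\pi_2(y)\propto p_2(y)\gamma_2(y)$ whenever acceptance has positive probability ($\pi_2$ is arbitrary otherwise), every $\sigma_1(\cdot\mid x)$ is optimal given $\pi_2,\sigma_2$, every $\sigma_2(\cdot\mid y)$ is optimal given $\pi_1,\sigma_1$,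 and every $\gamma_2(y)$ is optimal. It induces the allocation $$(q'(x,y),t'(x,y))=\gamma_2(y)\sum_{s_1,s_2}\sigma_1(s_1\mid x)\sigma_2(s_2\mid y)\,(q(s_1,s_2),t(s_1,s_2)).$$ $BR(\pi_1,G)$ is the set of all allocations so induced, and $BR(G)=\bigcup_{\pi_1\in\Delta(X)}BR(\pi_1,G)$. An *equilibrium* consists of probability measures $\gamma_1(x)$ on $\mathcal G$ ($x\in X$) and, for every $G\in\mathcal G$, a belief $\pi_1^G\in\Delta(X)$ and a sequential equilibrium of the continuation game given $(\pi_1^G,G)$, inducing an allocation $g_G$, such that: $G\mapsto\pi_1^G$ is a conditional distribution of $x$ given $G$ when $x\sim p_1$ and $G\sim\gamma_1(x)$; the integrals below exist; and $\int U_1^{g_G}(x)\,d\gamma_1(x)(G)\ge U_1^{g_{G'}}(x)$ for all $x\in X$, $G'\in\mathcal G$. Its *equilibrium allocation* has value $\int g_G(x,y)\,d\gamma_1(x)(G)$ at $(x,y)$. **Intuitive criterion.** Given an equilibrium allocation $g$ and a mechanism $G$, let $X(G)$ be the set of types $x$ such that $U_1^{g'}(x)<U_1^g(x)$ for all $g'\in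 BR(G)$. The allocation $g$ *passes the intuitive criterion* if there are no mechanism $G$ and type $x'\in X\setminus X(G)$ such that $U_1^{g'}(x')>U_1^g(x')$ for every $\pi_1\in\Delta(X\setminus X(G))$ and every $g'\in BR(\pi_1,G)$. **Theorem.** Suppose that $X=\{1,2\}$ or that $v_1^2(y)=0$ for all $y\in Y$. Let $\tilde g$ be an equilibrium allocation that passes the intuitive criterion. Then $U_1^{\tilde g}$ is the RSW payoff vector: an RSW allocation exists, and $U_1^{\tilde g}=U_1^{g^*}$ for every RSW allocation $g^*$. -/

import Mathlib

open MeasureTheory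

namespace InformedSeller

noncomputable section

/-- The trading environment: seller types `X = Fin n`, buyer types `Y = Fin m`, independent
full-support priors `p₁`, `p₂`, and additively separable nonnegative valuations, trader `i` having
valuation `vᵢ₁ x + vᵢ₂ y`. -/
structure Environment (n m : ℕ) where
  p₁ : Fin n → ℝ
  p₂ : Fin m → ℝ
  p₁_pos : ∀ x, 0 < p₁ x
  p₁_sum : ∑ x, p₁ x = 1
  p₂_pos : ∀ y, 0 < p₂ y
  p₂_sum : ∑ y, p₂ y = 1
  v₁₁ : Fin n → ℝ
  v₁₂ : Fin m → ℝ
  v₂₁ : Fin n → ℝ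
  v₂₂ : Fin m → ℝ
  v₁₁_strictMono : StrictMono v₁₁
  v₁₂_mono : Monotone v₁₂
  v₂₁_mono : Monotone v₂₁
  v₂₂_strictMono : StrictMono v₂₂
  v₁_nonneg : ∀ x y, 0 ≤ v₁₁ x + v₁₂ y
  v₂_nonneg : ∀ x y, 0 ≤ v₂₁ x + v₂₂ y

/-- A direct mechanism, also called an allocation: trading probabilities and payments. -/
@[ext]
structure Allocation (n m : ℕ) where
  q : Fin n → Fin m → ℝ
  t : Fin n → Fin m → ℝ
  q_mem : ∀ x y, q x y ∈ Set.Icc (0 : ℝ) 1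

/-- A mechanism: a finite strategic game form. A player who is inactive has exactly one action. -/
structure Mechanism where
  S₁ : Type
  S₂ : Type
  [fintype₁ : Fintype S₁]
  [fintype₂ : Fintype S₂]
  [nonempty₁ : Nonempty S₁]
  [nonempty₂ : Nonempty S₂]
  q : S₁ → S₂ → ℝ
  t : S₁ → S₂ → ℝ
  q_mem : ∀ s₁ s₂, q s₁ s₂ ∈ Set.Icc (0 : ℝ) 1

attribute [instance] Mechanism.fintype₁ Mechanism.fintype₂ Mechanism.nonempty₁ Mechanism.nonempty₂

variable {n m : ℕ}

namespace Environment

variable (E : Environment n m)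

/-- `U₁^g(x̂ ∣ x)`: interim payoff of seller type `x` reporting `x'`. -/
def sellerReport (g : Allocation n m) (x' x : Fin n) : ℝ :=
  ∑ y, E.p₂ y * (g.t x' y + (E.v₁₁ x + E.v₁₂ y) * (1 - g.q x' y))

/-- `U₁^g(x)`: the seller's interim payoff vector under truth-telling. -/
def sellerPayoff (g : Allocation n m) (x : Fin n) : ℝ := E.sellerReport g x x

/-- `u₂^g(ŷ ∣ x, y)`: ex post payoff of buyer type `y` reporting `y'` when the seller is `x`. -/
def buyerReport (g : Allocation n m) (y' : Fin m) (x : Fin n) (y : Fin m) : ℝ :=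
  (E.v₂₁ x + E.v₂₂ y) * g.q x y' - g.t x y'

/-- `g` is Bayesian incentive compatible for the seller. -/
def SellerBIC (g : Allocation n m) : Prop :=
  ∀ x x', E.sellerReport g x' x ≤ E.sellerPayoff g x

/-- `g` is ex post incentive compatible for the buyer. -/
def BuyerEPIC (g : Allocation n m) : Prop :=
  ∀ x y y', E.buyerReport g y' x y ≤ E.buyerReport g y x y

/-- `g` is ex post individually rational for the buyer. -/
def BuyerEPIR (g : Allocation n m) : Prop :=
  ∀ x y, 0 ≤ E.buyerReport g y x y

/-- The constraints of the problems that define an RSW allocation. -/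
def Safe (g : Allocation n m) : Prop :=
  E.SellerBIC g ∧ E.BuyerEPIC g ∧ E.BuyerEPIR g

/-- `g` is a Rothschild--Stiglitz--Wilson allocation: it satisfies the constraints and maximizes
every seller type's interim payoff among all allocations that satisfy them. -/
def IsRSW (g : Allocation n m) : Prop :=
  E.Safe g ∧ ∀ x, ∀ g', E.Safe g' → E.sellerPayoff g' x ≤ E.sellerPayoff g x

end Environment

/-- Behavioral strategies once the mechanism `G` has been offered: acceptance probabilities `γ₂`
of the buyer and mixed actions `σ₁`, `σ₂` of both players after acceptance. -/
structure Profile (n m : ℕ) (G : Mechanism) where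
  γ₂ : Fin m → ℝ
  σ₁ : Fin n → G.S₁ → ℝ
  σ₂ : Fin m → G.S₂ → ℝ
  γ₂_mem : ∀ y, γ₂ y ∈ Set.Icc (0 : ℝ) 1
  σ₁_mem : ∀ x, σ₁ x ∈ stdSimplex ℝ G.S₁
  σ₂_mem : ∀ y, σ₂ y ∈ stdSimplex ℝ G.S₂

namespace Profile

variable {G : Mechanism} (s : Profile n m G)

/-- The allocation induced by a profile; rejection leads to the no-trade outcome `(0, 0)`. -/
def allocation : Allocation n m where
  q x y := s.γ₂ y * ∑ s₁, ∑ s₂, s.σ₁ x s₁ * s.σ₂ y s₂ * G.q s₁ s₂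
  t x y := s.γ₂ y * ∑ s₁, ∑ s₂, s.σ₁ x s₁ * s.σ₂ y s₂ * G.t s₁ s₂
  q_mem x y := by
    have h1 := s.σ₁_mem x
    have h2 := s.σ₂_mem y
    have hw : ∀ a b, 0 ≤ s.σ₁ x a * s.σ₂ y b := fun a b => mul_nonneg (h1.1 a) (h2.1 b)
    have h0 : 0 ≤ ∑ a, ∑ b, s.σ₁ x a * s.σ₂ y b * G.q a b :=
      Finset.sum_nonneg fun a _ => Finset.sum_nonneg fun b _ => mul_nonneg (hw a b) (G.q_mem a b).1
    have hle : ∑ a, ∑ b, s.σ₁ x a * s.σ₂ y b * G.q a b ≤ 1 := by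
      calc ∑ a, ∑ b, s.σ₁ x a * s.σ₂ y b * G.q a b
          ≤ ∑ a, ∑ b, s.σ₁ x a * s.σ₂ y b :=
            Finset.sum_le_sum fun a _ => Finset.sum_le_sum fun b _ =>
              mul_le_of_le_one_right (hw a b) (G.q_mem a b).2
        _ = 1 := by rw [← Finset.sum_mul_sum, h1.2, h2.2, mul_one]
    exact ⟨mul_nonneg (s.γ₂_mem y).1 h0, mul_le_one₀ (s.γ₂_mem y).2 h0 hle⟩

/-- Expected payoff of seller type `x` from action `s₁` after acceptance, under belief `π₂`. -/
def sellerActionPayoff (E : Environment n m) (π₂ : Fin m → ℝ) (x : Fin n) (s₁ : G.S₁) : ℝ :=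
  ∑ y, π₂ y * ∑ s₂, s.σ₂ y s₂ * (G.t s₁ s₂ + (E.v₁₁ x + E.v₁₂ y) * (1 - G.q s₁ s₂))

/-- Expected payoff of buyer type `y` from action `s₂` after acceptance, under belief `π₁`. -/
def buyerActionPayoff (E : Environment n m) (π₁ : Fin n → ℝ) (y : Fin m) (s₂ : G.S₂) : ℝ :=
  ∑ x, π₁ x * ∑ s₁, s.σ₁ x s₁ * ((E.v₂₁ x + E.v₂₂ y) * G.q s₁ s₂ - G.t s₁ s₂)

/-- Expected payoff of buyer type `y` from accepting. -/
def acceptPayoff (E : Environment n m) (π₁ : Fin n → ℝ) (y : Fin m) : ℝ :=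
  ∑ s₂, s.σ₂ y s₂ * s.buyerActionPayoff E π₁ y s₂

/-- `(s, π₂)` is a sequential equilibrium assessment of the continuation game in which `G` has been
offered and the buyer's belief about the seller's type is `π₁`; `π₂` is the seller's belief about
the buyer's type after acceptance. Bayes' rule is written in product form, so that it leaves `π₂`
free exactly when acceptance has probability zero. -/
structure IsSequential (E : Environment n m) (π₁ : Fin n → ℝ) (π₂ : Fin m → ℝ) : Prop where
  belief_mem : π₂ ∈ stdSimplex ℝ (Fin m)
  bayes : ∀ y, π₂ y * ∑ y', E.p₂ y' * s.γ₂ y' = E.p₂ y * s.γ₂ y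
  seller_opt : ∀ x s₁', s.sellerActionPayoff E π₂ x s₁' ≤
    ∑ s₁, s.σ₁ x s₁ * s.sellerActionPayoff E π₂ x s₁
  buyer_opt : ∀ y s₂', s.buyerActionPayoff E π₁ y s₂' ≤ s.acceptPayoff E π₁ y
  accept_opt : ∀ y, ∀ a ∈ Set.Icc (0 : ℝ) 1, a * s.acceptPayoff E π₁ y ≤
    s.γ₂ y * s.acceptPayoff E π₁ y

end Profile

/-- An assessment of the mechanism-selection game: the seller's mechanism-selection plan, the
strategies after every offer, the buyer's beliefs after every offer, and the seller's beliefs after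
every acceptance. -/
structure Assessment (n m : ℕ) [MeasurableSpace Mechanism] where
  γ₁ : Fin n → Measure Mechanism
  prob : ∀ x, IsProbabilityMeasure (γ₁ x)
  cont : ∀ G : Mechanism, Profile n m G
  π₁ : Mechanism → Fin n → ℝ
  π₂ : Mechanism → Fin m → ℝ
  π₁_mem : ∀ G, π₁ G ∈ stdSimplex ℝ (Fin n)

namespace Assessment

variable [MeasurableSpace Mechanism]

/-- The marginal distribution of offers under the prior. -/
def offerLaw (A : Assessment n m) (E : Environment n m) : Measure Mechanism :=
  ∑ x, ENNReal.ofReal (E.p₁ x) • A.γ₁ x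

/-- The assessment is an equilibrium (sequentially rational and consistent).
`bayes`: the buyer's belief is a version of the conditional distribution of the seller's type given
the offer. `integrable_q`, `integrable_t`: the equilibrium allocation is well defined.
`offer_opt`: no seller type gains by offering another mechanism. -/
structure IsEquilibrium (A : Assessment n m) (E : Environment n m) : Prop where
  sequential : ∀ G, (A.cont G).IsSequential E (A.π₁ G) (A.π₂ G)
  measurable_belief : ∀ x, AEMeasurable (fun G => A.π₁ G x) (A.offerLaw E)
  bayes : ∀ x, ENNReal.ofReal (E.p₁ x) • A.γ₁ x =
    (A.offerLaw E).withDensity fun G => ENNReal.ofReal (A.π₁ G x)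
  integrable_q : ∀ x y, Integrable (fun G => (A.cont G).allocation.q x y) (A.γ₁ x)
  integrable_t : ∀ x y, Integrable (fun G => (A.cont G).allocation.t x y) (A.γ₁ x)
  offer_opt : ∀ x G', E.sellerPayoff (A.cont G').allocation x ≤
    ∫ G, E.sellerPayoff (A.cont G).allocation x ∂(A.γ₁ x)

end Assessment

namespace Environment

variable (E : Environment n m)

/-- `g` is the allocation induced by some equilibrium of the mechanism-selection game. -/
def IsEquilibriumAllocation [MeasurableSpace Mechanism] (g : Allocation n m) : Prop :=
  ∃ A : Assessment n m, A.IsEquilibrium E ∧ ∀ x y,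
    g.q x y = ∫ G, (A.cont G).allocation.q x y ∂(A.γ₁ x) ∧
    g.t x y = ∫ G, (A.cont G).allocation.t x y ∂(A.γ₁ x)

/-- `BR(π₁, G)`: sequential equilibrium allocations of the continuation game given `(π₁, G)`. -/
def BR (π₁ : Fin n → ℝ) (G : Mechanism) : Set (Allocation n m) :=
  {g' | ∃ (s : Profile n m G) (π₂ : Fin m → ℝ), s.IsSequential E π₁ π₂ ∧ g' = s.allocation}

/-- `BR(G)`: the union of `BR(π₁, G)` over all beliefs `π₁`. -/
def BRall (G : Mechanism) : Set (Allocation n m) :=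
  ⋃ π₁ ∈ stdSimplex ℝ (Fin n), E.BR π₁ G

/-- `D(x, G)`, given the equilibrium allocation `g`. -/
def D (g : Allocation n m) (x : Fin n) (G : Mechanism) : Set (Allocation n m) :=
  {g' ∈ E.BRall G | E.sellerPayoff g x < E.sellerPayoff g' x}

/-- `D⁰(x, G)`, given the equilibrium allocation `g`. -/
def D₀ (g : Allocation n m) (x : Fin n) (G : Mechanism) : Set (Allocation n m) :=
  {g' ∈ E.BRall G | E.sellerPayoff g' x = E.sellerPayoff g x}

/-- `X(G)`: the seller types that never have a weak incentive to deviate from `g` to `G`. -/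
def excluded (g : Allocation n m) (G : Mechanism) : Set (Fin n) :=
  {x | E.D g x G ∪ E.D₀ g x G = ∅}

/-- `g` passes the intuitive criterion. -/
def PassesIntuitive (g : Allocation n m) : Prop :=
  ¬ ∃ G : Mechanism, ∃ x' ∉ E.excluded g G,
    ∀ π₁ ∈ stdSimplex ℝ (Fin n), (∀ x ∈ E.excluded g G, π₁ x = 0) →
      ∀ g' ∈ E.BR π₁ G, E.sellerPayoff g x' < E.sellerPayoff g' x'

end Environment

end

end InformedSeller

open MeasureTheory

namespace InformedSeller

open Finset Filter Topology

/-! The seller's payoff from a report depends on that row of the allocation only through expected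
quantity and net revenue (`sellerReport_eq`). A row that is incentive compatible and rational for
the buyer pays at most what a lottery over posted prices earns, where the price aimed at buyer type
`k` has weight equal to the increment of `q` at `k` (`payment_le_of_incentive`).

The core is `exists_upsets`. Suppose a price lottery, priced for a buyer certain of seller type
`xs`, gives `xs` more than the equilibrium does, while no lower type would gain from the same
quantity at the equilibrium payoff of `xs`. Scaling the lottery down leaves `xs` a small gain and
makes every lower type lose strictly. It remains to find a mechanism all of whose continuation
equilibria have these properties. In `upsets_separating`, seller types from `xs` upward separate in
strictly dominant actions and prices follow the report, so the buyer's purchases do not depend on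
which of these types is believed; weight on lower types only reduces sales. With two seller types
and `xs` the lower one, a fixed menu suffices (`exists_upsets_bot`). Hence such a lottery cannot
beat an allocation that passes the intuitive criterion (`sum_margin_le`).

This bound is used twice. Upward induction on the seller type shows that no safe allocation pays
more than the equilibrium (`sellerPayoff_le_of_safe`). Conversely, the equilibrium meets the buyer's
constraints on average over seller types, and `exists_monotone_rows` makes each row monotone without
changing its expected quantity or the average over seller types. Repriced as lotteries, these rows
earn at least as much in total and, by the bound, at most as much row by row. So they earn the same,
and the repriced allocation is safe with the equilibrium payoffs (`exists_safe_sellerPayoff_eq`). -/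

/-! ### Monotone rows -/

/-- The increments `q k - q (k - 1)` of a row, with `q (-1) = 0`. -/
def increment {m : ℕ} (q : Fin m → ℝ) (k : Fin m) : ℝ :=
  q k - if h : 0 < k.val then q ⟨k.val - 1, by omega⟩ else 0

/-- One-sided telescoping: only local inequalities are needed, which is why downward-adjacent
incentive constraints and the lowest type's rationality bound all payments. -/
theorem sum_Iic_le_of_step {m : ℕ} {f F : Fin m → ℝ}
    (h0 : ∀ k : Fin m, k.val = 0 → f k ≤ F k)
    (hs : ∀ j k : Fin m, k.val = j.val + 1 → f k - f j ≤ F k) (y : Fin m) :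
    f y ≤ ∑ k ∈ Iic y, F k := by
  obtain ⟨i, hi⟩ := y
  induction i with
  | zero =>
    have : Iic (⟨0, hi⟩ : Fin m) = {⟨0, hi⟩} := by
      ext k; simp only [mem_Iic, mem_singleton, Fin.le_def, Fin.ext_iff]; omega
    rw [this, sum_singleton]
    exact h0 _ rfl
  | succ i ih =>
    have hi' : i < m := by omega
    have : Iic (⟨i + 1, hi⟩ : Fin m) = insert ⟨i + 1, hi⟩ (Iic ⟨i, hi'⟩) := by
      ext k; simp only [mem_Iic, mem_insert, Fin.le_def, Fin.ext_iff]; omega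
    rw [this, sum_insert (by simp [Fin.le_def])]
    have h1 := ih hi'
    have h2 := hs ⟨i, hi'⟩ ⟨i + 1, hi⟩ rfl
    linarith

theorem increment_zero {m : ℕ} (q : Fin m → ℝ) (k : Fin m) (hk : k.val = 0) :
    increment q k = q k := by
  simp [increment, hk]

theorem increment_succ {m : ℕ} (q : Fin m → ℝ) (j k : Fin m) (hk : k.val = j.val + 1) :
    increment q k = q k - q j := by
  have h : 0 < k.val := by omega
  have : (⟨k.val - 1, by omega⟩ : Fin m) = j := by ext; simp; omega
  simp [increment, h, this]

theorem increment_sum {n m : ℕ} (c : Fin n → ℝ) (q : Fin n → Fin m → ℝ) (k : Fin m) :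
    increment (fun y => ∑ x, c x * q x y) k = ∑ x, c x * increment (q x) k := by
  unfold increment
  split_ifs with hk
  · simp only [mul_sub, sum_sub_distrib]
  · simp

theorem sum_increment {m : ℕ} (q : Fin m → ℝ) (y : Fin m) :
    ∑ k ∈ Iic y, increment q k = q y := by
  apply le_antisymm
  · have := sum_Iic_le_of_step (f := fun k => -q k) (F := fun k => -increment q k)
      (fun k hk => by rw [increment_zero q k hk])
      (fun j k hk => by rw [increment_succ q j k hk]; linarith) y
    rw [sum_neg_distrib] at this
    linarith
  · exact sum_Iic_le_of_step (fun k hk => by rw [increment_zero q k hk])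
      (fun j k hk => by rw [increment_succ q j k hk]) y

theorem increment_nonneg {m : ℕ} {q : Fin m → ℝ} (h0 : ∀ y, 0 ≤ q y) (hq : Monotone q)
    (k : Fin m) : 0 ≤ increment q k := by
  unfold increment
  split_ifs with h
  · have : (⟨k.val - 1, by omega⟩ : Fin m) ≤ k := by simp [Fin.le_def]
    linarith [hq this]
  · linarith [h0 k]

theorem sum_increment_le_one {m : ℕ} {q : Fin m → ℝ} (h1 : ∀ y, q y ≤ 1) :
    ∑ k, increment q k ≤ 1 := by
  rcases m with _ | m
  · simp
  · have : (univ : Finset (Fin (m + 1))) = Iic (Fin.last m) := by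
      ext k; simp [Fin.le_last]
    rw [this, sum_increment]
    exact h1 _

/-- Summation by parts: the mass sold to the upper set `{y | k ≤ y}` is weighted by the
`k`-th increment. -/
theorem sum_mul_sum_Iic {m : ℕ} (c : Fin m → ℝ) (F : Fin m → ℝ) :
    ∑ y, c y * ∑ k ∈ Iic y, F k = ∑ k, F k * ∑ y ∈ Ici k, c y := by
  simp_rw [mul_sum]
  rw [sum_comm' (t' := univ) (s' := fun k => Ici k) (by intro x y; simp)]
  exact sum_congr rfl fun k _ => sum_congr rfl fun y _ => mul_comm _ _

/-- Incentive compatible rows are monotone. -/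
theorem monotone_of_incentive {m : ℕ} {v q t : Fin m → ℝ} (hv : StrictMono v)
    (hic : ∀ y y', v y * q y' - t y' ≤ v y * q y - t y) : Monotone q := by
  intro y y' hy
  rcases hy.eq_or_lt with rfl | hlt
  · rfl
  · have h1 := hic y y'
    have h2 := hic y' y
    have h3 := hv hlt
    by_contra hc
    push Not at hc
    nlinarith [mul_pos (sub_pos.2 h3) (sub_pos.2 hc)]

/-- Payments of an incentive compatible and individually rational row are bounded by those of the
mixture of posted prices with the same trading probabilities. -/
theorem payment_le_of_incentive {m : ℕ} {v q t : Fin m → ℝ}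
    (hic : ∀ y y', v y * q y' - t y' ≤ v y * q y - t y) (hir : ∀ y, 0 ≤ v y * q y - t y)
    (y : Fin m) : t y ≤ ∑ k ∈ Iic y, v k * increment q k := by
  refine sum_Iic_le_of_step (fun k hk => ?_) (fun j k hk => ?_) y
  · rw [increment_zero q k hk]; linarith [hir k]
  · rw [increment_succ q j k hk]; linarith [hic k j]

/-- The mixture of posted prices with monotone trading probabilities `q` is incentive compatible. -/
theorem incentive_of_monotone {m : ℕ} {v q : Fin m → ℝ} (hv : StrictMono v)
    (h0 : ∀ y, 0 ≤ q y) (hq : Monotone q) (y y' : Fin m) :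
    v y * q y' - ∑ k ∈ Iic y', v k * increment q k ≤
      v y * q y - ∑ k ∈ Iic y, v k * increment q k := by
  have key : ∀ z, v y * q z - ∑ k ∈ Iic z, v k * increment q k =
      ∑ k ∈ Iic z, (v y - v k) * increment q k := by
    intro z
    rw [← sum_increment q z, mul_sum, ← sum_sub_distrib]
    exact sum_congr rfl fun k _ => by ring
  rw [key, key]
  have hinc := increment_nonneg h0 hq
  rcases le_total y' y with hle | hle
  · refine sum_le_sum_of_subset_of_nonneg (Iic_subset_Iic.2 hle) fun k hk _ => ?_
    exact mul_nonneg (sub_nonneg.2 (hv.monotone (mem_Iic.1 hk))) (hinc k)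
  · rw [← sum_sdiff (Iic_subset_Iic.2 hle)]
    have : ∑ k ∈ Iic y' \ Iic y, (v y - v k) * increment q k ≤ 0 := by
      refine sum_nonpos fun k hk => ?_
      have hk' : y < k := by simpa using (mem_sdiff.1 hk).2
      exact mul_nonpos_of_nonpos_of_nonneg (sub_nonpos.2 (hv.monotone hk'.le)) (hinc k)
    linarith

theorem rational_of_monotone {m : ℕ} {v q : Fin m → ℝ} (hv : StrictMono v)
    (h0 : ∀ y, 0 ≤ q y) (hq : Monotone q) (y : Fin m) :
    0 ≤ v y * q y - ∑ k ∈ Iic y, v k * increment q k := by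
  rw [← sum_increment q y, mul_sum, ← sum_sub_distrib]
  refine sum_nonneg fun k hk => ?_
  rw [← sub_mul]
  have hk' := hv.monotone (mem_Iic.1 hk)
  have := increment_nonneg h0 hq k
  exact mul_nonneg (sub_nonneg.2 hk') this

/-! ### A sum inequality for antitone functions -/

/-- `f` changes sign at most once, from nonnegative to negative. Compared with the constant weight
`h j` at the first negative point `j`, the weight `h` is larger before and smaller after, so it can
only raise the sum. -/
theorem sum_mul_nonneg_of_antitone {ι : Type*} [LinearOrder ι] (s : Finset ι) {p f h : ι → ℝ}
    (hp : ∀ y ∈ s, 0 ≤ p y) (hf : AntitoneOn f s) (hh : AntitoneOn h s) (h0 : ∀ y ∈ s, 0 ≤ h y)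
    (hsum : 0 ≤ ∑ y ∈ s, p y * f y) : 0 ≤ ∑ y ∈ s, p y * (h y * f y) := by
  by_cases hall : ∀ y ∈ s, 0 ≤ f y
  · exact sum_nonneg fun y hy => mul_nonneg (hp y hy) (mul_nonneg (h0 y hy) (hall y hy))
  · push Not at hall
    have hne : (s.filter fun y => f y < 0).Nonempty := by
      obtain ⟨y, hy, hfy⟩ := hall
      exact ⟨y, by simp [hy, hfy]⟩
    set j := (s.filter fun y => f y < 0).min' hne with hj
    have hjm : j ∈ s ∧ f j < 0 := by simpa using min'_mem _ hne
    have hpt : ∀ y ∈ s, h j * (p y * f y) ≤ p y * (h y * f y) := by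
      intro y hy
      have : h j * f y ≤ h y * f y := by
        rcases lt_or_ge y j with hlt | hge
        · have hfy : 0 ≤ f y := by
            by_contra hc
            push Not at hc
            exact absurd (min'_le _ y (by simp [hy, hc])) (not_le.2 hlt)
          exact mul_le_mul_of_nonneg_right (hh hy hjm.1 hlt.le) hfy
        · exact mul_le_mul_of_nonpos_right (hh hjm.1 hy hge)
            ((hf hjm.1 hy hge).trans hjm.2.le)
      nlinarith [mul_le_mul_of_nonneg_left this (hp y hy)]
    calc (0 : ℝ) ≤ h j * ∑ y ∈ s, p y * f y := mul_nonneg (h0 j hjm.1) hsum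
      _ = ∑ y ∈ s, h j * (p y * f y) := mul_sum _ _ _
      _ ≤ _ := sum_le_sum hpt

/-! ### Monotone rearrangement of trading probabilities -/

/-- Minimize the weighted sum of squares over all matrices with the given marginals. If a row of the
minimizer fell from `y` to `y'`, monotonicity of the column averages would force another row to rise
there, and shifting mass around the resulting rectangle would lower the objective. -/
theorem exists_monotone_rows {n m : ℕ} {p₁ : Fin n → ℝ} {p₂ : Fin m → ℝ} (hp₁ : ∀ x, 0 < p₁ x)
    (hp₂ : ∀ y, 0 < p₂ y) {q : Fin n → Fin m → ℝ} (hq : ∀ x y, q x y ∈ Set.Icc (0 : ℝ) 1)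
    (hmono : Monotone fun y => ∑ x, p₁ x * q x y) :
    ∃ q' : Fin n → Fin m → ℝ, (∀ x y, q' x y ∈ Set.Icc (0 : ℝ) 1) ∧
      (∀ x, ∑ y, p₂ y * q' x y = ∑ y, p₂ y * q x y) ∧
      (∀ y, ∑ x, p₁ x * q' x y = ∑ x, p₁ x * q x y) ∧ ∀ x, Monotone (q' x) := by
  let K : Set (Fin n → Fin m → ℝ) :=
    (Set.univ.pi fun _ => Set.univ.pi fun _ => Set.Icc (0 : ℝ) 1) ∩
      {r | (∀ x, ∑ y, p₂ y * r x y = ∑ y, p₂ y * q x y) ∧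
        ∀ y, ∑ x, p₁ x * r x y = ∑ x, p₁ x * q x y}
  have hK : IsCompact K := by
    refine (isCompact_univ_pi fun _ => isCompact_univ_pi fun _ => isCompact_Icc).inter_right ?_
    rw [Set.ofPred_and, Set.ofPred_forall, Set.ofPred_forall]
    refine (isClosed_iInter fun x => isClosed_eq (by fun_prop) (by fun_prop)).inter
      (isClosed_iInter fun y => isClosed_eq (by fun_prop) (by fun_prop))
  have hqK : q ∈ K := ⟨fun x _ y _ => hq x y, fun _ => rfl, fun _ => rfl⟩
  let F : (Fin n → Fin m → ℝ) → ℝ := fun r => ∑ x, ∑ y, p₁ x * p₂ y * r x y ^ 2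
  obtain ⟨r, hrK, hmin⟩ := hK.exists_isMinOn ⟨q, hqK⟩
    (f := F) (Continuous.continuousOn (by fun_prop))
  obtain ⟨hr01, hrow, hcol⟩ := hrK
  have hr01' : ∀ x y, r x y ∈ Set.Icc (0 : ℝ) 1 :=
    fun x y => hr01 x trivial y trivial
  refine ⟨r, hr01', hrow, hcol, fun x y y' hyy => ?_⟩
  by_contra hlt
  push Not at hlt
  have hne : y ≠ y' := by rintro rfl; exact lt_irrefl _ hlt
  obtain ⟨x', hx'⟩ : ∃ x', r x' y < r x' y' := by
    by_contra hc
    push Not at hc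
    have h1 : ∑ x, p₁ x * r x y ≤ ∑ x, p₁ x * r x y' := by
      rw [hcol, hcol]; exact hmono hyy
    have h2 : ∑ x, p₁ x * r x y' < ∑ x, p₁ x * r x y :=
      sum_lt_sum (fun i _ => mul_le_mul_of_nonneg_left (hc i) (hp₁ i).le)
        ⟨x, mem_univ _, mul_lt_mul_of_pos_left hlt (hp₁ x)⟩
    linarith
  have hxx : x ≠ x' := by rintro rfl; exact lt_asymm hlt hx'
  -- The perturbation is the rank-one matrix `α i * ζ j`. Dividing by the priors makes both factors
  -- have weighted sum zero, so all marginals are preserved.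
  let α : Fin n → ℝ := Pi.single x (p₁ x)⁻¹ - Pi.single x' (p₁ x')⁻¹
  let ζ : Fin m → ℝ := Pi.single y' (p₂ y')⁻¹ - Pi.single y (p₂ y)⁻¹
  have hα : ∀ f : Fin n → ℝ, ∑ i, p₁ i * (α i * f i) = f x - f x' := by
    intro f
    simp only [α, Pi.sub_apply, sub_mul, mul_sub, sum_sub_distrib, Pi.single_apply, ite_mul,
      zero_mul, mul_ite, mul_zero, sum_ite_eq', mem_univ, if_true]
    rw [mul_inv_cancel_left₀ (hp₁ x).ne', mul_inv_cancel_left₀ (hp₁ x').ne']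
  have hζ : ∀ f : Fin m → ℝ, ∑ j, p₂ j * (ζ j * f j) = f y' - f y := by
    intro f
    simp only [ζ, Pi.sub_apply, sub_mul, mul_sub, sum_sub_distrib, Pi.single_apply, ite_mul,
      zero_mul, mul_ite, mul_zero, sum_ite_eq', mem_univ, if_true]
    rw [mul_inv_cancel_left₀ (hp₂ y).ne', mul_inv_cancel_left₀ (hp₂ y').ne']
  have hαx : 0 < α x := by simp [α, hxx, hp₁ x]
  have hαx' : α x' < 0 := by simp [α, hxx.symm, hp₁ x']
  have hαo : ∀ i, i ≠ x → i ≠ x' → α i = 0 := fun i h1 h2 => by simp [α, h1, h2]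
  have hζy : ζ y < 0 := by simp [ζ, hne, hp₂ y]
  have hζy' : 0 < ζ y' := by simp [ζ, hne.symm, hp₂ y']
  have hζo : ∀ i, i ≠ y → i ≠ y' → ζ i = 0 := fun i h1 h2 => by simp [ζ, h1, h2]
  have hdir : ∀ i j, (0 < α i * ζ j → r i j < 1) ∧ (α i * ζ j < 0 → 0 < r i j) := by
    intro i j
    by_cases hi : i = x
    · subst hi
      by_cases hj : j = y
      · subst hj
        exact ⟨fun h => absurd h (mul_neg_of_pos_of_neg hαx hζy).not_gt,
          fun _ => (hr01' _ _).1.trans_lt hlt⟩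
      by_cases hj' : j = y'
      · subst hj'
        exact ⟨fun _ => hlt.trans_le (hr01' _ _).2,
          fun h => absurd h (mul_pos hαx hζy').not_gt⟩
      simp [hζo j hj hj']
    by_cases hi' : i = x'
    · subst hi'
      by_cases hj : j = y
      · subst hj
        exact ⟨fun _ => hx'.trans_le (hr01' _ _).2,
          fun h => absurd h (mul_pos_of_neg_of_neg hαx' hζy).not_gt⟩
      by_cases hj' : j = y'
      · subst hj'
        exact ⟨fun h => absurd h (mul_neg_of_neg_of_pos hαx' hζy').not_gt,
          fun _ => (hr01' _ _).1.trans_lt hx'⟩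
      simp [hζo j hj hj']
    simp [hαo i hi hi']
  have hfeas : ∀ᶠ s in 𝓝[>] (0 : ℝ), ∀ i j, r i j + s * (α i * ζ j) ∈ Set.Icc (0 : ℝ) 1 := by
    refine eventually_all.2 fun i => eventually_all.2 fun j => ?_
    have hc : Tendsto (fun s : ℝ => r i j + s * (α i * ζ j)) (𝓝[>] 0) (𝓝 (r i j)) := by
      have : Continuous fun s : ℝ => r i j + s * (α i * ζ j) := by fun_prop
      simpa using (this.tendsto 0).mono_left nhdsWithin_le_nhds
    have hs : ∀ᶠ s in 𝓝[>] (0 : ℝ), 0 < s := eventually_mem_nhdsWithin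
    rcases lt_trichotomy (α i * ζ j) 0 with h | h | h
    · filter_upwards [hs, hc.eventually (lt_mem_nhds ((hdir i j).2 h))] with s h1 h2
      exact ⟨h2.le, by nlinarith [(hr01' i j).2, mul_neg_of_pos_of_neg h1 h]⟩
    · filter_upwards with s
      simpa [h] using hr01' i j
    · filter_upwards [hs, hc.eventually (gt_mem_nhds ((hdir i j).1 h))] with s h1 h2
      exact ⟨by nlinarith [(hr01' i j).1, mul_pos h1 h], h2.le⟩
  -- The objective changes by `-2 * s * D + s ^ 2 * C`, which is negative for small positive `s`.
  let D : ℝ := (r x y - r x y') + (r x' y' - r x' y)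
  have hD : 0 < D := by simp only [D]; linarith
  let C : ℝ := ∑ i, ∑ j, p₁ i * p₂ j * (α i * ζ j) ^ 2
  have hsmall : ∀ᶠ s in 𝓝[>] (0 : ℝ), s * C < 2 * D := by
    have : Tendsto (fun s : ℝ => s * C) (𝓝[>] 0) (𝓝 0) := by
      have : Continuous fun s : ℝ => s * C := by fun_prop
      simpa using (this.tendsto 0).mono_left nhdsWithin_le_nhds
    exact this.eventually (gt_mem_nhds (by linarith))
  have hpos : ∀ᶠ s in 𝓝[>] (0 : ℝ), 0 < s := eventually_mem_nhdsWithin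
  obtain ⟨s, hs1, hs2, hs0⟩ := (hfeas.and (hsmall.and hpos)).exists
  let r' : Fin n → Fin m → ℝ := fun i j => r i j + s * (α i * ζ j)
  have hr'K : r' ∈ K := by
    refine ⟨fun i _ j _ => hs1 i j, fun i => ?_, fun j => ?_⟩
    · have h1 : ∑ j, p₂ j * r' i j = ∑ j, p₂ j * r i j + s * α i * ∑ j, p₂ j * (ζ j * 1) := by
        rw [mul_sum, ← sum_add_distrib]
        exact sum_congr rfl fun j _ => by simp only [r']; ring
      rw [h1, hζ (fun _ => 1), hrow]; simp
    · have h1 : ∑ i, p₁ i * r' i j = ∑ i, p₁ i * r i j + s * ζ j * ∑ i, p₁ i * (α i * 1) := by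
        rw [mul_sum, ← sum_add_distrib]
        exact sum_congr rfl fun j _ => by simp only [r']; ring
      rw [h1, hα (fun _ => 1), hcol]; simp
  have hF : F r' = F r + 2 * s * ∑ i, p₁ i * (α i * ∑ j, p₂ j * (ζ j * r i j)) + s ^ 2 * C := by
    simp only [F, C, r', mul_sum, ← sum_add_distrib]
    exact sum_congr rfl fun i _ => sum_congr rfl fun j _ => by ring
  rw [hα (fun i => ∑ j, p₂ j * (ζ j * r i j)), hζ (fun j => r x j), hζ (fun j => r x' j)] at hF
  have hle : F r ≤ F r' := hmin hr'K
  have : s * (s * C) < s * (2 * D) := mul_lt_mul_of_pos_left hs2 hs0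
  have hD' : D = (r x y - r x y') + (r x' y' - r x' y) := rfl
  nlinarith

/-! ### Retention shares -/

/-- Shares retained by the seller types above a given one so that, when shares are sold at the
increasing prices `M`, sellers with costs `V` have no incentive to imitate each other. -/
noncomputable def share (M V : ℕ → ℝ) : ℕ → ℝ
  | 0 => 1
  | j + 1 => if M (j + 1) < V (j + 1) then 0 else share M V j * (M j - V j) / (M (j + 1) - V j)

section share
variable {M V : ℕ → ℝ}

/-- The third clause carries the induction: as long as the share is nonzero the price covers the
cost, so the next quotient has nonnegative numerator and denominator. -/
theorem share_nonneg_and (hM : Monotone M) (hV : Monotone V) (h0 : V 0 ≤ M 0) (j : ℕ) :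
    0 ≤ share M V j ∧ share M V j ≤ 1 ∧ (share M V j ≠ 0 → V j ≤ M j) := by
  induction j with
  | zero => simp [share, h0]
  | succ j ih =>
    obtain ⟨i0, i1, i2⟩ := ih
    simp only [share]
    split_ifs with h
    · simp
    · push Not at h
      have hVj := hV (Nat.le_succ j)
      have hMj := hM (Nat.le_succ j)
      simp only [Nat.succ_eq_add_one] at hVj hMj
      by_cases hz : share M V j = 0
      · simp [hz, h]
      have h3 := i2 hz
      refine ⟨div_nonneg (mul_nonneg i0 (by linarith)) (by linarith), ?_, fun _ => h⟩
      refine div_le_one_of_le₀ ?_ (by linarith)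
      nlinarith

/-- Before the cutoff the recursion makes cost `V j` indifferent between reports `j` and `j + 1`. As
shares decrease, higher costs prefer the later report and lower costs the earlier one. -/
theorem share_step (hM : Monotone M) (hV : Monotone V) (h0 : V 0 ≤ M 0) (j : ℕ) (v : ℝ) :
    (V (j + 1) ≤ v → share M V j * (M j - v) ≤ share M V (j + 1) * (M (j + 1) - v)) ∧
    (v ≤ V j → share M V (j + 1) * (M (j + 1) - v) ≤ share M V j * (M j - v)) := by
  obtain ⟨i0, i1, i2⟩ := share_nonneg_and hM hV h0 j
  have hVj := hV (Nat.le_succ j)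
  have hMj := hM (Nat.le_succ j)
  simp only [Nat.succ_eq_add_one] at hVj hMj
  by_cases h : M (j + 1) < V (j + 1)
  · simp only [share, h, if_true, zero_mul]
    refine ⟨fun hv => mul_nonpos_of_nonneg_of_nonpos i0 (by linarith), fun hv => ?_⟩
    by_cases hz : share M V j = 0
    · simp [hz]
    · exact mul_nonneg i0 (by linarith [i2 hz])
  · have key : share M V (j + 1) * (M (j + 1) - V j) = share M V j * (M j - V j) := by
      simp only [share, h, if_false]
      -- Division by zero gives share zero; this is harmless because the margin `M j - V j` then
      -- vanishes too, unless the share already does.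
      by_cases hd : M (j + 1) - V j = 0
      · by_cases hz : share M V j = 0
        · simp [hz]
        · have := i2 hz
          have : M j - V j = 0 := by linarith
          simp [this]
      · exact div_mul_cancel₀ _ hd
    have hle : share M V (j + 1) ≤ share M V j := by
      simp only [share, h, if_false]
      push Not at h
      by_cases hz : share M V j = 0
      · simp [hz]
      have h3 := i2 hz
      refine div_le_of_le_mul₀ (by linarith) i0 (by nlinarith)
    constructor
    · intro hv
      nlinarith
    · intro hv
      nlinarith

theorem share_optimal (hM : Monotone M) (hV : Monotone V) (h0 : V 0 ≤ M 0) (i : ℕ) {v : ℝ}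
    (hv : v = V i ∨ i = 0 ∧ v ≤ V 0) (j : ℕ) :
    share M V j * (M j - v) ≤ share M V i * (M i - v) := by
  rcases le_total j i with hji | hij
  · obtain rfl | ⟨rfl, -⟩ := hv
    · refine Nat.decreasingInduction' (fun k hk _ ih => ?_) hji le_rfl
      exact ((share_step hM hV h0 k _).1 (hV hk)).trans ih
    · obtain rfl : j = 0 := by omega
      rfl
  · have hv' : v ≤ V i := by
      obtain rfl | ⟨rfl, h⟩ := hv
      · rfl
      · exact h
    induction j, hij using Nat.le_induction with
    | base => rfl
    | succ j hj ih => exact ((share_step hM hV h0 j _).2 (hv'.trans (hV hj))).trans ih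

end share

section

variable {n m : ℕ}

/-! ### Payoffs in continuation games -/

namespace Profile

variable {G : Mechanism} (s : Profile n m G) (E : Environment n m)

/-- The rejection term does not depend on the imitated type, and the product form of Bayes' rule
factors out the acceptance probability even when it is zero. Optimal actions after acceptance thus
give interim incentive compatibility. -/
theorem sellerReport_allocation {π₂ : Fin m → ℝ}
    (hb : ∀ y, π₂ y * ∑ y', E.p₂ y' * s.γ₂ y' = E.p₂ y * s.γ₂ y) (x' x : Fin n) :
    E.sellerReport s.allocation x' x =
      ∑ y, E.p₂ y * (1 - s.γ₂ y) * (E.v₁₁ x + E.v₁₂ y) +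
        (∑ y', E.p₂ y' * s.γ₂ y') * ∑ a, s.σ₁ x' a * s.sellerActionPayoff E π₂ x a := by
  set P := ∑ y', E.p₂ y' * s.γ₂ y' with hP
  have h1 : P * ∑ a, s.σ₁ x' a * s.sellerActionPayoff E π₂ x a =
      ∑ y, E.p₂ y * s.γ₂ y * ∑ a, ∑ b, s.σ₁ x' a * s.σ₂ y b *
        (G.t a b + (E.v₁₁ x + E.v₁₂ y) * (1 - G.q a b)) := by
    simp only [sellerActionPayoff, mul_sum]
    simp_rw [← hb]
    rw [sum_comm]
    exact sum_congr rfl fun y _ => sum_congr rfl fun a _ => sum_congr rfl fun b _ => by ring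
  rw [h1, ← sum_add_distrib]
  unfold Environment.sellerReport
  refine sum_congr rfl fun y _ => ?_
  have h2 : ∑ a, ∑ b, s.σ₁ x' a * s.σ₂ y b *
        (G.t a b + (E.v₁₁ x + E.v₁₂ y) * (1 - G.q a b)) =
      ∑ a, ∑ b, s.σ₁ x' a * s.σ₂ y b * G.t a b + (E.v₁₁ x + E.v₁₂ y) *
        (∑ a, ∑ b, s.σ₁ x' a * s.σ₂ y b - ∑ a, ∑ b, s.σ₁ x' a * s.σ₂ y b * G.q a b) := by
    simp only [← sum_sub_distrib, mul_sum, ← sum_add_distrib]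
    exact sum_congr rfl fun a _ => sum_congr rfl fun b _ => by ring
  have h3 : ∑ a, ∑ b, s.σ₁ x' a * s.σ₂ y b = 1 := by
    rw [← sum_mul_sum, (s.σ₁_mem x').2, (s.σ₂_mem y).2, mul_one]
  rw [h2, h3]
  simp only [allocation]
  ring

theorem sum_buyerReport_allocation (π₁ : Fin n → ℝ) (y' y : Fin m) :
    ∑ x, π₁ x * E.buyerReport s.allocation y' x y =
      s.γ₂ y' * ∑ b, s.σ₂ y' b * s.buyerActionPayoff E π₁ y b := by
  simp only [Environment.buyerReport, allocation, buyerActionPayoff, mul_sum, ← sum_sub_distrib]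
  conv_rhs => rw [sum_comm]
  refine sum_congr rfl fun x _ => ?_
  conv_lhs => rw [sum_comm]
  exact sum_congr rfl fun a _ => sum_congr rfl fun b _ => by ring

variable {s E} {π₁ : Fin n → ℝ} {π₂ : Fin m → ℝ}

theorem IsSequential.sellerBIC (h : s.IsSequential E π₁ π₂) : E.SellerBIC s.allocation := by
  intro x x'
  unfold Environment.sellerPayoff
  rw [s.sellerReport_allocation E h.bayes, s.sellerReport_allocation E h.bayes]
  refine add_le_add le_rfl (mul_le_mul_of_nonneg_left ?_
    (sum_nonneg fun y _ => mul_nonneg (E.p₂_pos y).le (s.γ₂_mem y).1))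
  calc ∑ a, s.σ₁ x' a * s.sellerActionPayoff E π₂ x a
      ≤ ∑ a, s.σ₁ x' a * ∑ b, s.σ₁ x b * s.sellerActionPayoff E π₂ x b :=
        sum_le_sum fun a _ => mul_le_mul_of_nonneg_left (h.seller_opt x a) ((s.σ₁_mem x').1 a)
    _ = _ := by rw [← sum_mul, (s.σ₁_mem x').2, one_mul]

theorem IsSequential.buyer_incentive (h : s.IsSequential E π₁ π₂) (y y' : Fin m) :
    ∑ x, π₁ x * E.buyerReport s.allocation y' x y ≤
      ∑ x, π₁ x * E.buyerReport s.allocation y x y := by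
  rw [s.sum_buyerReport_allocation, s.sum_buyerReport_allocation]
  calc s.γ₂ y' * ∑ b, s.σ₂ y' b * s.buyerActionPayoff E π₁ y b
      ≤ s.γ₂ y' * ∑ b, s.σ₂ y' b * s.acceptPayoff E π₁ y :=
        mul_le_mul_of_nonneg_left (sum_le_sum fun b _ =>
          mul_le_mul_of_nonneg_left (h.buyer_opt y b) ((s.σ₂_mem y').1 b)) (s.γ₂_mem y').1
    _ = s.γ₂ y' * s.acceptPayoff E π₁ y := by rw [← sum_mul, (s.σ₂_mem y').2, one_mul]
    _ ≤ _ := h.accept_opt y _ (s.γ₂_mem y')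

theorem IsSequential.buyer_rational (h : s.IsSequential E π₁ π₂) (y : Fin m) :
    0 ≤ ∑ x, π₁ x * E.buyerReport s.allocation y x y := by
  rw [s.sum_buyerReport_allocation]
  have := h.accept_opt y 0 (by simp)
  rwa [zero_mul] at this

end Profile

/-! ### Equilibrium allocations -/

namespace Environment

variable (E : Environment n m)

/-- The payoff of seller type `x` from keeping the good. -/
noncomputable def keepPayoff (x : Fin n) : ℝ := ∑ y, E.p₂ y * (E.v₁₁ x + E.v₁₂ y)

end Environment

/-- The mechanism that never trades. -/
def noTrade : Mechanism where
  S₁ := Unit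
  S₂ := Unit
  q _ _ := 0
  t _ _ := 0
  q_mem _ _ := by simp

theorem sellerPayoff_noTrade (E : Environment n m) (s : Profile n m noTrade) (x : Fin n) :
    E.sellerPayoff s.allocation x = E.keepPayoff x := by
  simp [Environment.sellerPayoff, Environment.sellerReport, Environment.keepPayoff,
    Profile.allocation, noTrade]

section equilibrium

variable [MeasurableSpace Mechanism] {E : Environment n m} {A : Assessment n m}

theorem Assessment.IsEquilibrium.integrable_sellerReport (hA : A.IsEquilibrium E) (x' x : Fin n) :
    Integrable (fun G => E.sellerReport (A.cont G).allocation x' x) (A.γ₁ x') := by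
  have := A.prob x'
  unfold Environment.sellerReport
  refine integrable_finsetSum _ fun y _ => Integrable.const_mul ?_ _
  exact (hA.integrable_t x' y).add
    (((integrable_const 1).sub (hA.integrable_q x' y)).const_mul _)

variable {g : Allocation n m}

theorem sellerReport_eq_integral (hA : A.IsEquilibrium E)
    (hg : ∀ x y, g.q x y = ∫ G, (A.cont G).allocation.q x y ∂(A.γ₁ x) ∧
      g.t x y = ∫ G, (A.cont G).allocation.t x y ∂(A.γ₁ x)) (x' x : Fin n) :
    E.sellerReport g x' x = ∫ G, E.sellerReport (A.cont G).allocation x' x ∂(A.γ₁ x') := by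
  have := A.prob x'
  unfold Environment.sellerReport
  rw [integral_finsetSum]
  · refine sum_congr rfl fun y _ => ?_
    have hc : Integrable (fun G => 1 - (A.cont G).allocation.q x' y) (A.γ₁ x') :=
      (integrable_const 1).sub (hA.integrable_q x' y)
    rw [integral_const_mul, integral_add (hA.integrable_t x' y) (hc.const_mul _),
      integral_const_mul, integral_sub (integrable_const 1) (hA.integrable_q x' y),
      (hg x' y).1, (hg x' y).2]
    simp
  · intro y _
    refine Integrable.const_mul ?_ _
    exact (hA.integrable_t x' y).add
      (((integrable_const 1).sub (hA.integrable_q x' y)).const_mul _)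

/-- Imitating `x'` means drawing its offers and then playing its actions. After each offer this is
no better than playing as `x`, which is no better than the equilibrium payoff of `x`. -/
theorem Environment.IsEquilibriumAllocation.sellerBIC (hg : E.IsEquilibriumAllocation g) :
    E.SellerBIC g := by
  obtain ⟨A, hA, hg⟩ := hg
  intro x x'
  have := A.prob x'
  have h1 : E.sellerPayoff g x = ∫ G, E.sellerPayoff (A.cont G).allocation x ∂(A.γ₁ x) :=
    sellerReport_eq_integral hA hg x x
  rw [sellerReport_eq_integral hA hg]
  calc ∫ G, E.sellerReport (A.cont G).allocation x' x ∂(A.γ₁ x')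
      ≤ ∫ _, E.sellerPayoff g x ∂(A.γ₁ x') :=
        integral_mono (hA.integrable_sellerReport x' x) (integrable_const _) fun G =>
          ((hA.sequential G).sellerBIC x x').trans (h1 ▸ hA.offer_opt x G)
    _ = _ := by simp

theorem Environment.IsEquilibriumAllocation.keepPayoff_le (hg : E.IsEquilibriumAllocation g)
    (x : Fin n) : E.keepPayoff x ≤ E.sellerPayoff g x := by
  obtain ⟨A, hA, hg⟩ := hg
  have h1 : E.sellerPayoff g x = ∫ G, E.sellerPayoff (A.cont G).allocation x ∂(A.γ₁ x) :=
    sellerReport_eq_integral hA hg x x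
  rw [h1, ← sellerPayoff_noTrade E (A.cont noTrade) x]
  exact hA.offer_opt x noTrade

/-- Bayes' rule makes the belief a density with respect to the law of offers. Integrals over
type-dependent offers become integrals over one common law, where the buyer's constraints hold offer
by offer. -/
theorem Assessment.IsEquilibrium.integrable_and_integral (hA : A.IsEquilibrium E)
    {f : Mechanism → ℝ} {x : Fin n} (hf : Integrable f (A.γ₁ x)) :
    Integrable (fun G => A.π₁ G x * f G) (A.offerLaw E) ∧
      E.p₁ x * ∫ G, f G ∂(A.γ₁ x) = ∫ G, A.π₁ G x * f G ∂(A.offerLaw E) := by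
  have hm : AEMeasurable (fun G => ENNReal.ofReal (A.π₁ G x)) (A.offerLaw E) :=
    (hA.measurable_belief x).ennreal_ofReal
  have hfin : ∀ᵐ G ∂(A.offerLaw E), ENNReal.ofReal (A.π₁ G x) < ⊤ :=
    ae_of_all _ fun _ => ENNReal.ofReal_lt_top
  have hsm : Integrable f (ENNReal.ofReal (E.p₁ x) • A.γ₁ x) := hf.smul_measure ENNReal.ofReal_ne_top
  have hπ : ∀ G, (ENNReal.ofReal (A.π₁ G x)).toReal = A.π₁ G x := fun G =>
    ENNReal.toReal_ofReal ((A.π₁_mem G).1 x)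
  have h_int : E.p₁ x * ∫ G, f G ∂(A.γ₁ x) = ∫ G, f G ∂(ENNReal.ofReal (E.p₁ x) • A.γ₁ x) := by
    rw [integral_smul_measure, ENNReal.toReal_ofReal (E.p₁_pos x).le, smul_eq_mul]
  rw [h_int]
  rw [hA.bayes x] at hsm ⊢
  constructor
  · have := (integrable_withDensity_iff_integrable_smul₀' hm hfin).1 hsm
    simpa [hπ] using this
  · rw [integral_withDensity_eq_integral_toReal_smul₀ hm hfin]
    simp [hπ]

theorem sum_buyerReport_eq_integral (hA : A.IsEquilibrium E)
    (hg : ∀ x y, g.q x y = ∫ G, (A.cont G).allocation.q x y ∂(A.γ₁ x) ∧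
      g.t x y = ∫ G, (A.cont G).allocation.t x y ∂(A.γ₁ x)) (y' y : Fin m) :
    Integrable (fun G => ∑ x, A.π₁ G x * E.buyerReport (A.cont G).allocation y' x y)
        (A.offerLaw E) ∧
      ∑ x, E.p₁ x * E.buyerReport g y' x y =
        ∫ G, ∑ x, A.π₁ G x * E.buyerReport (A.cont G).allocation y' x y ∂(A.offerLaw E) := by
  have h_int : ∀ x, Integrable (fun G => E.buyerReport (A.cont G).allocation y' x y) (A.γ₁ x) :=
    fun x => ((hA.integrable_q x y').const_mul _).sub (hA.integrable_t x y')
  refine ⟨integrable_finsetSum _ fun x _ => (hA.integrable_and_integral (h_int x)).1, ?_⟩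
  rw [integral_finsetSum _ fun x _ => (hA.integrable_and_integral (h_int x)).1]
  refine sum_congr rfl fun x _ => ?_
  rw [← (hA.integrable_and_integral (h_int x)).2]
  congr 1
  simp only [Environment.buyerReport]
  rw [integral_sub ((hA.integrable_q x y').const_mul _) (hA.integrable_t x y'),
    integral_const_mul, (hg x y').1, (hg x y').2]

theorem Environment.IsEquilibriumAllocation.buyer_incentive (hg : E.IsEquilibriumAllocation g)
    (y y' : Fin m) : ∑ x, E.p₁ x * E.buyerReport g y' x y ≤
      ∑ x, E.p₁ x * E.buyerReport g y x y := by
  obtain ⟨A, hA, hg⟩ := hg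
  rw [(sum_buyerReport_eq_integral hA hg y' y).2, (sum_buyerReport_eq_integral hA hg y y).2]
  exact integral_mono (sum_buyerReport_eq_integral hA hg y' y).1
    (sum_buyerReport_eq_integral hA hg y y).1 fun G => (hA.sequential G).buyer_incentive y y'

theorem Environment.IsEquilibriumAllocation.buyer_rational (hg : E.IsEquilibriumAllocation g)
    (y : Fin m) : 0 ≤ ∑ x, E.p₁ x * E.buyerReport g y x y := by
  obtain ⟨A, hA, hg⟩ := hg
  rw [(sum_buyerReport_eq_integral hA hg y y).2]
  exact integral_nonneg fun G => (hA.sequential G).buyer_rational y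

end equilibrium

end

section

variable {n m : ℕ}

/-! ### Menus of increments -/

/-- The mechanism in which the buyer selects a set of increments. The seller's action `a` fixes the
baseline outcome `(h a, H a)` and the terms `(θ a k, r a k)` of every increment `k`. -/
def menu {A : Type} [Fintype A] [Nonempty A] (h H : A → ℝ) (θ r : A → Fin m → ℝ)
    (h0 : ∀ a, 0 ≤ h a) (hθ : ∀ a k, 0 ≤ θ a k) (h1 : ∀ a, h a + ∑ k, θ a k ≤ 1) : Mechanism where
  S₁ := A
  S₂ := Finset (Fin m)
  q a S := h a + ∑ k ∈ S, θ a k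
  t a S := H a + ∑ k ∈ S, r a k
  q_mem a S := ⟨add_nonneg (h0 a) (sum_nonneg fun k _ => hθ a k),
    (add_le_add le_rfl (sum_le_sum_of_subset_of_nonneg (subset_univ S) fun k _ _ => hθ a k)).trans
      (h1 a)⟩

theorem eq_one_of_support {ι : Type*} [Fintype ι] {σ : ι → ℝ} (hσ : σ ∈ stdSimplex ℝ ι) {i : ι}
    (h : ∀ j, j ≠ i → σ j = 0) : σ i = 1 := by
  rw [← hσ.2]
  exact (sum_eq_single i (fun j _ hj => h j hj) (by simp)).symm

theorem apply_eq_of_optimal {ι : Type*} [Fintype ι] {σ f : ι → ℝ} (hσ : σ ∈ stdSimplex ℝ ι)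
    (h : ∀ j, f j ≤ ∑ i, σ i * f i) {i : ι} (hi : σ i ≠ 0) : f i = ∑ i, σ i * f i := by
  set c := ∑ i, σ i * f i with hc
  have h0 : ∑ j, σ j * (c - f j) = 0 := by
    simp only [mul_sub, sum_sub_distrib, ← sum_mul, hσ.2, one_mul]
    rw [← hc, sub_self]
  have := (sum_eq_zero_iff_of_nonneg fun j _ =>
    mul_nonneg (hσ.1 j) (sub_nonneg.2 (h j))).1 h0 i (mem_univ _)
  rcases mul_eq_zero.1 this with h' | h'
  · exact absurd h' hi
  · linarith

theorem sum_powerset_mul (σ : Finset (Fin m) → ℝ) (c : Fin m → ℝ) :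
    ∑ S, σ S * ∑ k ∈ S, c k = ∑ k, (∑ S, if k ∈ S then σ S else 0) * c k := by
  simp_rw [sum_mul]
  rw [sum_comm]
  refine sum_congr rfl fun S _ => ?_
  rw [mul_sum, ← sum_filter_add_sum_filter_not univ (fun k => k ∈ S)]
  have h1 : ∑ k with k ∉ S, (if k ∈ S then σ S else 0) * c k = 0 :=
    sum_eq_zero fun k hk => by simp [(mem_filter.1 hk).2]
  rw [h1, add_zero]
  have h2 : univ.filter (fun k => k ∈ S) = S := by ext; simp
  rw [h2]
  exact sum_congr rfl fun k hk => by simp [hk]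

section menu

variable (E : Environment n m) {A : Type} [Fintype A] [Nonempty A]

/-- Payoff of seller type `x` from action `a` in a menu when buyer type `y` buys increment `k` with
probability `β y k`. -/
noncomputable def menuValue (h H : A → ℝ) (θ r : A → Fin m → ℝ) (β : Fin m → Fin m → ℝ)
    (x : Fin n) (a : A) : ℝ :=
  ∑ y, E.p₂ y * (H a + (E.v₁₁ x + E.v₁₂ y) * (1 - h a) +
    ∑ k, β y k * (r a k - (E.v₁₁ x + E.v₁₂ y) * θ a k))

/-- Expected surplus of buyer type `y` from increment `k` if seller types play `α`. -/
noncomputable def menuSurplus (θ r : A → Fin m → ℝ) (α : Fin n → A) (π₁ : Fin n → ℝ)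
    (y k : Fin m) : ℝ :=
  ∑ x, π₁ x * ((E.v₂₁ x + E.v₂₂ y) * θ (α x) k - r (α x) k)

variable {h H : A → ℝ} {θ r : A → Fin m → ℝ} {h0 : ∀ a, 0 ≤ h a} {hθ : ∀ a k, 0 ≤ θ a k}
  {h1 : ∀ a, h a + ∑ k, θ a k ≤ 1}

theorem menu_sellerActionPayoff (s : Profile n m (menu h H θ r h0 hθ h1)) (x : Fin n) (a : A) :
    s.sellerActionPayoff E E.p₂ x a =
      menuValue E h H θ r (fun y k => ∑ S : Finset (Fin m), if k ∈ S then s.σ₂ y S else 0) x a := by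
  unfold Profile.sellerActionPayoff menuValue
  refine sum_congr rfl fun y _ => ?_
  congr 1
  have key : ∀ σ : Finset (Fin m) → ℝ, ∑ S, σ S = 1 →
      ∑ S, σ S * ((H a + ∑ k ∈ S, r a k) + (E.v₁₁ x + E.v₁₂ y) * (1 - (h a + ∑ k ∈ S, θ a k))) =
        H a + (E.v₁₁ x + E.v₁₂ y) * (1 - h a) +
          ∑ k, (∑ S, if k ∈ S then σ S else 0) * (r a k - (E.v₁₁ x + E.v₁₂ y) * θ a k) := by
    intro σ hσ
    rw [← sum_powerset_mul, ← one_mul (H a + _), ← hσ, sum_mul, ← sum_add_distrib]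
    refine sum_congr rfl fun S _ => ?_
    rw [sum_sub_distrib, ← mul_sum]
    ring
  exact key (s.σ₂ y) (s.σ₂_mem y).2

theorem menu_buyerActionPayoff (s : Profile n m (menu h H θ r h0 hθ h1)) (π₁ : Fin n → ℝ)
    (y : Fin m) (S : Finset (Fin m)) :
    s.buyerActionPayoff E π₁ y S =
      ∑ x, π₁ x * ∑ a : A, s.σ₁ x a * ((E.v₂₁ x + E.v₂₂ y) * h a - H a) +
      ∑ k ∈ S, ∑ x, π₁ x * ∑ a : A, s.σ₁ x a * ((E.v₂₁ x + E.v₂₂ y) * θ a k - r a k) := by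
  rw [sum_comm, ← sum_add_distrib]
  unfold Profile.buyerActionPayoff
  refine sum_congr rfl fun x _ => ?_
  rw [← mul_sum, ← mul_add]
  congr 1
  rw [sum_comm, ← sum_add_distrib]
  refine sum_congr rfl fun a _ => ?_
  rw [← mul_sum, ← mul_add]
  congr 1
  change (E.v₂₁ x + E.v₂₂ y) * (h a + ∑ k ∈ S, θ a k) - (H a + ∑ k ∈ S, r a k) = _
  rw [sum_sub_distrib, ← mul_sum]
  ring

variable {E}

theorem sum_single_mul {ι : Type*} [Fintype ι] {σ : ι → ℝ} {i : ι}
    (h1 : σ i = 1) (h : ∀ j, j ≠ i → σ j = 0) (f : ι → ℝ) : ∑ j, σ j * f j = f i := by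
  rw [sum_eq_single i (fun j _ hj => by rw [h j hj, zero_mul]) (by simp), h1, one_mul]

/-- Outcomes of a menu in which every seller type `x` has the strictly dominant action `α x` and in
which the buyer strictly gains from the baseline outcome. -/
theorem menu_outcome (hbase : ∀ x y a, 0 < (E.v₂₁ x + E.v₂₂ y) * h a - H a) {α : Fin n → A}
    (hdom : ∀ β : Fin m → Fin m → ℝ, (∀ y k, β y k ∈ Set.Icc (0 : ℝ) 1) → ∀ x a, a ≠ α x →
      menuValue E h H θ r β x a < menuValue E h H θ r β x (α x))
    {π₁ : Fin n → ℝ} (hπ : π₁ ∈ stdSimplex ℝ (Fin n)) {g : Allocation n m}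
    (hg : g ∈ E.BR π₁ (menu h H θ r h0 hθ h1)) :
    ∃ β : Fin m → Fin m → ℝ, (∀ y k, β y k ∈ Set.Icc (0 : ℝ) 1) ∧
      (∀ y k, 0 < menuSurplus E θ r α π₁ y k → β y k = 1) ∧
      (∀ y k, menuSurplus E θ r α π₁ y k < 0 → β y k = 0) ∧
      ∀ x, E.sellerPayoff g x = menuValue E h H θ r β x (α x) := by
  obtain ⟨s, π₂, hs, rfl⟩ := hg
  have hσ₂ : ∀ y, ∑ S : Finset (Fin m), s.σ₂ y S = 1 := fun y => (s.σ₂_mem y).2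
  have hβ : ∀ y k, (∑ S : Finset (Fin m), if k ∈ S then s.σ₂ y S else 0) ∈ Set.Icc (0 : ℝ) 1 := by
    intro y k
    have hnn : ∀ S : Finset (Fin m), 0 ≤ s.σ₂ y S := (s.σ₂_mem y).1
    refine ⟨sum_nonneg fun S _ => by split_ifs <;> simp [hnn S], ?_⟩
    rw [← hσ₂ y]
    exact sum_le_sum fun S _ => by split_ifs <;> simp [hnn S]
  have hacc : ∀ y, 0 < s.acceptPayoff E π₁ y := by
    intro y
    refine lt_of_lt_of_le ?_ (hs.buyer_opt y (∅ : Finset (Fin m)))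
    rw [menu_buyerActionPayoff]
    simp only [sum_empty, add_zero]
    have hpos : ∀ x, 0 < ∑ a : A, s.σ₁ x a * ((E.v₂₁ x + E.v₂₂ y) * h a - H a) := by
      intro x
      have hs1 : ∑ a : A, s.σ₁ x a = 1 := (s.σ₁_mem x).2
      have hnn : ∀ a : A, 0 ≤ s.σ₁ x a := (s.σ₁_mem x).1
      obtain ⟨a, -, ha⟩ : ∃ a ∈ (univ : Finset A), s.σ₁ x a ≠ 0 :=
        exists_ne_zero_of_sum_ne_zero (by rw [hs1]; exact one_ne_zero)
      exact sum_pos' (fun b _ => mul_nonneg (hnn b) (hbase x y b).le)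
        ⟨a, mem_univ _, mul_pos (lt_of_le_of_ne (hnn a) (Ne.symm ha)) (hbase x y a)⟩
    obtain ⟨x, -, hx⟩ : ∃ x ∈ (univ : Finset (Fin n)), π₁ x ≠ 0 :=
      exists_ne_zero_of_sum_ne_zero (by rw [hπ.2]; exact one_ne_zero)
    exact sum_pos' (fun x _ => mul_nonneg (hπ.1 x) (hpos x).le)
      ⟨x, mem_univ _, mul_pos (lt_of_le_of_ne (hπ.1 x) (Ne.symm hx)) (hpos x)⟩
  -- Strict gains from the baseline force acceptance, so the seller's belief is the prior and no
  -- freedom off the path remains.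
  have hγ : ∀ y, s.γ₂ y = 1 := by
    intro y
    have := hs.accept_opt y 1 (by simp)
    exact le_antisymm (s.γ₂_mem y).2 (le_of_mul_le_mul_right this (hacc y))
  have hπ₂ : π₂ = E.p₂ := by
    funext y
    have := hs.bayes y
    simpa [hγ, E.p₂_sum] using this
  subst hπ₂
  have hother : ∀ x, ∀ a : A, a ≠ α x → s.σ₁ x a = 0 := by
    intro x a ha
    by_contra hne
    have h2 := apply_eq_of_optimal (s.σ₁_mem x) (hs.seller_opt x) hne
    have h3 := hs.seller_opt x (α x)
    rw [← h2, menu_sellerActionPayoff, menu_sellerActionPayoff] at h3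
    exact absurd h3 (not_le.2 (hdom _ hβ x a ha))
  have hself : ∀ x, s.σ₁ x (α x) = 1 := fun x => eq_one_of_support (s.σ₁_mem x) (hother x)
  have hbuy : ∀ y (S : Finset (Fin m)), s.buyerActionPayoff E π₁ y S =
      ∑ x, π₁ x * ((E.v₂₁ x + E.v₂₂ y) * h (α x) - H (α x)) +
        ∑ k ∈ S, menuSurplus E θ r α π₁ y k := by
    intro y S
    rw [menu_buyerActionPayoff]
    unfold menuSurplus
    congr 1
    · exact sum_congr rfl fun x _ => by rw [sum_single_mul (hself x) (hother x)]
    · exact sum_congr rfl fun k _ => sum_congr rfl fun x _ => by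
        rw [sum_single_mul (hself x) (hother x)]
  have hopt : ∀ y (S S' : Finset (Fin m)), s.σ₂ y S ≠ 0 →
      ∑ k ∈ S', menuSurplus E θ r α π₁ y k ≤ ∑ k ∈ S, menuSurplus E θ r α π₁ y k := by
    intro y S S' hS
    have h2 := apply_eq_of_optimal (s.σ₂_mem y) (hs.buyer_opt y) hS
    have h3 := hs.buyer_opt y S'
    unfold Profile.acceptPayoff at h3
    rw [← h2, hbuy, hbuy] at h3
    linarith
  -- Surplus is additive over increments, so inserting or erasing a single one shows that the sign
  -- of its surplus decides the purchase.
  refine ⟨_, hβ, fun y k hk => ?_, fun y k hk => ?_, fun x => ?_⟩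
  · rw [← hσ₂ y]
    refine sum_congr rfl fun S _ => ?_
    split_ifs with hkS
    · rfl
    · by_contra hne
      have := hopt y S (insert k S) (Ne.symm hne)
      rw [sum_insert hkS] at this
      linarith
  · refine sum_eq_zero fun S _ => ?_
    split_ifs with hkS
    · by_contra hne
      have := hopt y S (S.erase k) hne
      rw [← add_sum_erase S _ hkS] at this
      linarith
    · rfl
  · unfold Environment.sellerPayoff
    rw [s.sellerReport_allocation E hs.bayes, ← menu_sellerActionPayoff]
    simp only [hγ, sub_self, mul_zero, zero_mul, sum_const_zero, mul_one, E.p₂_sum, one_mul,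
      zero_add]
    exact sum_single_mul (hself x) (hother x) _

/-- The dominant actions and purchase of exactly the increments with positive surplus form an
equilibrium. Existence is needed because a type that gains in every response is outside `X(G)` only
if some response exists. -/
theorem menu_BR_nonempty (hbase : ∀ x y a, 0 < (E.v₂₁ x + E.v₂₂ y) * h a - H a) {α : Fin n → A}
    (hdom : ∀ β : Fin m → Fin m → ℝ, (∀ y k, β y k ∈ Set.Icc (0 : ℝ) 1) → ∀ x a, a ≠ α x →
      menuValue E h H θ r β x a < menuValue E h H θ r β x (α x))
    {π₁ : Fin n → ℝ} (hπ : π₁ ∈ stdSimplex ℝ (Fin n)) :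
    (E.BR π₁ (menu h H θ r h0 hθ h1)).Nonempty := by
  classical
  let T : Fin m → Finset (Fin m) := fun y => {k | 0 < menuSurplus E θ r α π₁ y k}
  let s : Profile n m (menu h H θ r h0 hθ h1) :=
    { γ₂ := fun _ => 1
      σ₁ := fun x => (Pi.single (α x) 1 : A → ℝ)
      σ₂ := fun y => (Pi.single (T y) 1 : Finset (Fin m) → ℝ)
      γ₂_mem := fun _ => by simp
      σ₁_mem := fun x => single_mem_stdSimplex ℝ (α x)
      σ₂_mem := fun y => single_mem_stdSimplex ℝ (T y) }
  have hself : ∀ x, s.σ₁ x (α x) = 1 := fun x => Pi.single_eq_same (M := fun _ => ℝ) (α x) 1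
  have hother : ∀ x, ∀ a : A, a ≠ α x → s.σ₁ x a = 0 := fun x a ha =>
    Pi.single_eq_of_ne (M := fun _ => ℝ) ha 1
  have hself₂ : ∀ y, s.σ₂ y (T y) = 1 := fun y => Pi.single_eq_same (M := fun _ => ℝ) (T y) 1
  have hother₂ : ∀ y, ∀ S : Finset (Fin m), S ≠ T y → s.σ₂ y S = 0 := fun y S hS =>
    Pi.single_eq_of_ne (M := fun _ => ℝ) hS 1
  have hbuy : ∀ y (S : Finset (Fin m)), s.buyerActionPayoff E π₁ y S =
      ∑ x, π₁ x * ((E.v₂₁ x + E.v₂₂ y) * h (α x) - H (α x)) +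
        ∑ k ∈ S, menuSurplus E θ r α π₁ y k := by
    intro y S
    rw [menu_buyerActionPayoff]
    unfold menuSurplus
    congr 1
    · exact sum_congr rfl fun x _ => by rw [sum_single_mul (hself x) (hother x)]
    · exact sum_congr rfl fun k _ => sum_congr rfl fun x _ => by
        rw [sum_single_mul (hself x) (hother x)]
  have hacc : ∀ y, s.acceptPayoff E π₁ y = s.buyerActionPayoff E π₁ y (T y) := fun y =>
    sum_single_mul (hself₂ y) (hother₂ y) _
  refine ⟨s.allocation, s, E.p₂, ⟨⟨fun y => (E.p₂_pos y).le, E.p₂_sum⟩, fun y => ?_,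
    fun x a => ?_, fun y S => ?_, fun y c hc => ?_⟩, rfl⟩
  · simp [s, E.p₂_sum]
  · have hsum : ∑ b, s.σ₁ x b * s.sellerActionPayoff E E.p₂ x b =
        s.sellerActionPayoff E E.p₂ x (α x) := sum_single_mul (hself x) (hother x) _
    rw [hsum, menu_sellerActionPayoff E s x a, menu_sellerActionPayoff]
    by_cases ha : a = α x
    · rw [ha]
    · refine (hdom _ (fun y k => ?_) x a ha).le
      have hnn : ∀ S : Finset (Fin m), 0 ≤ s.σ₂ y S := (s.σ₂_mem y).1
      have hσ₂ : ∑ S : Finset (Fin m), s.σ₂ y S = 1 := (s.σ₂_mem y).2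
      refine ⟨sum_nonneg fun S _ => by split_ifs <;> simp [hnn S], ?_⟩
      rw [← hσ₂]
      exact sum_le_sum fun S _ => by split_ifs <;> simp [hnn S]
  · rw [hacc, hbuy y S, hbuy]
    refine add_le_add le_rfl ?_
    rw [sum_filter]
    calc ∑ k ∈ S, menuSurplus E θ r α π₁ y k
        ≤ ∑ k ∈ S, (if 0 < menuSurplus E θ r α π₁ y k then menuSurplus E θ r α π₁ y k else 0) :=
          sum_le_sum fun k _ => by split_ifs with hk <;> linarith
      _ ≤ _ := sum_le_sum_of_subset_of_nonneg (subset_univ S) fun k _ _ => by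
          split_ifs with hk <;> linarith
  · have : 0 ≤ s.acceptPayoff E π₁ y := by
      rw [hacc, hbuy]
      refine add_nonneg (sum_nonneg fun x _ => mul_nonneg (hπ.1 x) (hbase x y (α x)).le)
        (sum_nonneg fun k hk => ?_)
      exact (mem_filter.1 hk).2.le
    exact mul_le_mul_of_nonneg_right hc.2 this

end menu

end

section

variable {n m : ℕ}

/-! ### Profitable deviations -/

/-- Mechanisms that upset the payoff vector `u` by the intuitive criterion: types below `xs` lose
under every belief, and `xs` gains whenever beliefs exclude the types below it. -/
structure Upsets (E : Environment n m) (u : Fin n → ℝ) (xs : Fin n) (G : Mechanism) : Prop where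
  lower_lose : ∀ π₁ ∈ stdSimplex ℝ (Fin n), ∀ g ∈ E.BR π₁ G, ∀ x < xs, E.sellerPayoff g x < u x
  gain : ∀ π₁ ∈ stdSimplex ℝ (Fin n), (∀ x < xs, π₁ x = 0) → ∀ g ∈ E.BR π₁ G,
    u xs < E.sellerPayoff g xs
  nonempty : ∀ π₁ ∈ stdSimplex ℝ (Fin n), (E.BR π₁ G).Nonempty

/-- Every lower type lies in `X(G)`, while a response to the point belief on `xs` keeps `xs` out.
Whether higher types are excluded does not matter, since the gain of `xs` survives any weight on
them. -/
theorem Upsets.not_passesIntuitive {E : Environment n m} {g : Allocation n m} {xs : Fin n}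
    {G : Mechanism} (h : Upsets E (E.sellerPayoff g) xs G) : ¬ E.PassesIntuitive g := by
  classical
  refine not_not_intro ⟨G, xs, fun hx => ?_, fun π₁ hπ hex g' hg' => h.gain π₁ hπ ?_ g' hg'⟩
  · have hπ := single_mem_stdSimplex ℝ xs
    obtain ⟨g', hg'⟩ := h.nonempty _ hπ
    have hgain := h.gain _ hπ (fun x hx => Pi.single_eq_of_ne hx.ne _) g' hg'
    have hmem : g' ∈ E.D g xs G ∪ E.D₀ g xs G :=
      Or.inl ⟨Set.mem_biUnion (t := fun π₁ => E.BR π₁ G) hπ hg', hgain⟩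
    rw [show E.D g xs G ∪ E.D₀ g xs G = ∅ from hx] at hmem
    exact hmem
  · intro x hx
    refine hex x (Set.eq_empty_of_forall_notMem fun g'' hg'' => ?_)
    rcases hg'' with ⟨hB, hlt⟩ | ⟨hB, heq⟩
    · obtain ⟨π, hπ', hB⟩ := Set.mem_iUnion₂.1 hB
      exact lt_asymm hlt (h.lower_lose π hπ' _ hB x hx)
    · obtain ⟨π, hπ', hB⟩ := Set.mem_iUnion₂.1 hB
      exact (h.lower_lose π hπ' _ hB x hx).ne heq

/-- Expected gain of seller type `x` from posting the price at which buyer type `k` is indifferent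
when the buyer believes in the seller type `xs`. -/
noncomputable def margin (E : Environment n m) (xs x : Fin n) (k : Fin m) : ℝ :=
  ∑ y ∈ Ici k, E.p₂ y * (E.v₂₁ xs + E.v₂₂ k - (E.v₁₁ x + E.v₁₂ y))

/-- The probability of the buyer types above `k`. -/
noncomputable def tail (E : Environment n m) (k : Fin m) : ℝ := ∑ y ∈ Ici k, E.p₂ y

variable (E : Environment n m)

theorem tail_pos (k : Fin m) : 0 < tail E k :=
  sum_pos (fun y _ => E.p₂_pos y) ⟨k, by simp⟩

theorem margin_eq (xs x : Fin n) (k : Fin m) :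
    margin E xs x k = margin E xs xs k + (E.v₁₁ xs - E.v₁₁ x) * tail E k := by
  simp only [margin, tail, mul_sum, ← sum_add_distrib]
  exact sum_congr rfl fun y _ => by ring

/-- The summand's gain decreases in `y`, so a nonnegative weighted sum forces it to be nonnegative
at the smallest index `k`. -/
theorem valuation_le_of_margin_nonneg {xs : Fin n} {k : Fin m} (h : 0 ≤ margin E xs xs k) :
    E.v₁₁ xs + E.v₁₂ k ≤ E.v₂₁ xs + E.v₂₂ k := by
  by_contra hc
  push Not at hc
  have : margin E xs xs k < 0 := by
    refine sum_neg (fun y hy => mul_neg_of_pos_of_neg (E.p₂_pos y) ?_) ⟨k, by simp⟩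
    have := E.v₁₂_mono (mem_Ici.1 hy)
    linarith
  linarith

theorem menuValue_eq {A : Type} {h H : A → ℝ} {θ r : A → Fin m → ℝ} {a : A} {c : Fin m → ℝ}
    (hr : ∀ k, r a k = θ a k * c k) (β : Fin m → Fin m → ℝ) (x : Fin n) :
    menuValue E h H θ r β x a = E.keepPayoff x + H a - h a * E.keepPayoff x +
      ∑ k, θ a k * ∑ y, E.p₂ y * (β y k * (c k - (E.v₁₁ x + E.v₁₂ y))) := by
  have h1 : E.keepPayoff x + H a - h a * E.keepPayoff x =
      ∑ y, E.p₂ y * (H a + (E.v₁₁ x + E.v₁₂ y) * (1 - h a)) := by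
    have : H a = ∑ y, E.p₂ y * H a := by rw [← sum_mul, E.p₂_sum, one_mul]
    rw [this]
    simp only [Environment.keepPayoff, mul_sum, ← sum_add_distrib, ← sum_sub_distrib]
    exact sum_congr rfl fun y _ => by
      rw [← sum_mul, E.p₂_sum]
      ring
  rw [h1]
  simp only [mul_sum]
  rw [sum_comm, ← sum_add_distrib]
  unfold menuValue
  refine sum_congr rfl fun y _ => ?_
  rw [mul_add, mul_sum]
  congr 1
  exact sum_congr rfl fun k _ => by rw [hr]; ring

/-- A posted menu upsets the payoff of the lowest type: optimism of the buyer raises sales, and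
additional sales are profitable. -/
theorem exists_upsets_bot {xs : Fin n} (hbot : ∀ x, xs ≤ x) {w : Fin m → ℝ} (hw : ∀ k, 0 ≤ w k)
    (hw1 : ∑ k, w k ≤ 1) (hm : ∀ k, 0 < w k → 0 ≤ margin E xs xs k) {u : Fin n → ℝ}
    (hu : u xs < E.keepPayoff xs + ∑ k, w k * margin E xs xs k) :
    ∃ G, Upsets E u xs G := by
  -- The slack is split in three: one `ε` bribes the buyer to accept, at most one is lost to price
  -- discounts, and the last keeps the gain strict.
  set ε : ℝ := (E.keepPayoff xs + ∑ k, w k * margin E xs xs k - u xs) / 3 with hεd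
  have hε : 0 < ε := by rw [hεd]; linarith
  let c : Fin m → ℝ := fun k => E.v₂₁ xs + E.v₂₂ k - ε
  let h : Unit → ℝ := fun _ => 0
  let H : Unit → ℝ := fun _ => -ε
  let θ : Unit → Fin m → ℝ := fun _ k => w k
  let r : Unit → Fin m → ℝ := fun _ k => w k * c k
  have h0 : ∀ a, 0 ≤ h a := fun _ => le_rfl
  have hθ : ∀ a k, 0 ≤ θ a k := fun _ => hw
  have h1 : ∀ a, h a + ∑ k, θ a k ≤ 1 := fun _ => by simpa [h, θ] using hw1
  have hbase : ∀ x y a, 0 < (E.v₂₁ x + E.v₂₂ y) * h a - H a := fun x y a => by simpa [h, H] using hε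
  let α : Fin n → Unit := fun _ => ()
  have hdom : ∀ β : Fin m → Fin m → ℝ, (∀ y k, β y k ∈ Set.Icc (0 : ℝ) 1) → ∀ x a, a ≠ α x →
      menuValue E h H θ r β x a < menuValue E h H θ r β x (α x) :=
    fun β _ x a ha => absurd rfl ha
  refine ⟨menu h H θ r h0 hθ h1, ⟨fun _ _ _ _ x hx => absurd (hbot x) (not_le.2 hx),
    fun π₁ hπ _ g hg => ?_, fun π₁ hπ => menu_BR_nonempty hbase hdom hπ⟩⟩
  obtain ⟨β, hβ, hβ1, -, hval⟩ := menu_outcome hbase hdom hπ hg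
  rw [hval, menuValue_eq E (c := c) (fun k => rfl)]
  have hk : ∀ k, w k * (margin E xs xs k - ε) ≤
      θ (α xs) k * ∑ y, E.p₂ y * (β y k * (c k - (E.v₁₁ xs + E.v₁₂ y))) := by
    intro k
    rcases (hw k).eq_or_lt with hz | hpos
    · simp [θ, ← hz]
    refine mul_le_mul_of_nonneg_left ?_ hpos.le
    have hone : ∀ y ∈ Ici k, β y k = 1 := by
      intro y hy
      refine hβ1 y k ?_
      have hv := E.v₂₂_strictMono.monotone (mem_Ici.1 hy)
      have hterm : ∀ x, w k * ε ≤ (E.v₂₁ x + E.v₂₂ y) * θ (α x) k - r (α x) k := by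
        intro x
        have hx := E.v₂₁_mono (hbot x)
        simp only [θ, r, c]
        nlinarith
      calc (0 : ℝ) < w k * ε := mul_pos hpos hε
        _ = ∑ x, π₁ x * (w k * ε) := by rw [← sum_mul, hπ.2, one_mul]
        _ ≤ _ := sum_le_sum fun x _ => mul_le_mul_of_nonneg_left (hterm x) (hπ.1 x)
    have hle : ∀ y, E.p₂ y * (if k ≤ y then E.v₂₁ xs + E.v₂₂ k - (E.v₁₁ xs + E.v₁₂ y) else 0) -
        E.p₂ y * ε ≤ E.p₂ y * (β y k * (c k - (E.v₁₁ xs + E.v₁₂ y))) := by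
      intro y
      rw [← mul_sub]
      refine mul_le_mul_of_nonneg_left ?_ (E.p₂_pos y).le
      split_ifs with hy
      · rw [hone y (mem_Ici.2 hy)]
        simp only [c]
        linarith
      · have h2 := valuation_le_of_margin_nonneg E (hm k hpos)
        have h3 := E.v₁₂_mono (not_le.1 hy).le
        have h4 := hβ y k
        simp only [c]
        nlinarith [mul_nonneg h4.1 (show 0 ≤ E.v₂₁ xs + E.v₂₂ k - (E.v₁₁ xs + E.v₁₂ y) by linarith),
          mul_le_mul_of_nonneg_right h4.2 hε.le]
    calc margin E xs xs k - ε = ∑ y, (E.p₂ y * (if k ≤ y then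
          E.v₂₁ xs + E.v₂₂ k - (E.v₁₁ xs + E.v₁₂ y) else 0) - E.p₂ y * ε) := by
          rw [sum_sub_distrib, ← sum_mul, E.p₂_sum, one_mul, margin]
          congr 1
          simp only [mul_ite, mul_zero]
          rw [← sum_filter]
          congr 1
          ext y; simp
      _ ≤ _ := sum_le_sum fun y _ => hle y
  have hsum := sum_le_sum fun k (_ : k ∈ univ) => hk k
  have h2 : ∑ k, w k * (margin E xs xs k - ε) =
      ∑ k, w k * margin E xs xs k - (∑ k, w k) * ε := by
    simp only [mul_sub, sum_sub_distrib, ← sum_mul]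
  rw [h2] at hsum
  have h3 : (∑ k, w k) * ε ≤ ε := mul_le_of_le_one_left hε.le hw1
  simp only [h, H, zero_mul]
  linarith

/-- A family of shares that makes truthful reporting optimal for sellers of type at least `xs`. -/
theorem exists_shares {xs : Fin n} {k : Fin m} (hk : E.v₁₁ xs ≤ E.v₂₁ xs + E.v₂₂ k) :
    ∃ ϑ : Fin n → ℝ, (∀ a, ϑ a ∈ Set.Icc (0 : ℝ) 1) ∧ ϑ xs = 1 ∧
      ∀ x a, xs ≤ a → ϑ a * (E.v₂₁ a + E.v₂₂ k - E.v₁₁ x) ≤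
        ϑ (max x xs) * (E.v₂₁ (max x xs) + E.v₂₂ k - E.v₁₁ x) := by
  have hn : 0 < n := xs.pos
  -- Shares start at `xs`; indices beyond the top type are clamped, which keeps costs and prices
  -- monotone on all of `ℕ`.
  let idx : ℕ → Fin n := fun j => ⟨min (xs.val + j) (n - 1), by omega⟩
  have hidx : Monotone idx := fun i j hij => by
    simp only [idx, Fin.mk_le_mk]; omega
  have hidx' : ∀ a : Fin n, xs ≤ a → idx (a.val - xs.val) = a := by
    intro a ha
    have := Fin.le_def.1 ha
    ext; simp only [idx]; omega
  let M : ℕ → ℝ := fun j => E.v₂₁ (idx j) + E.v₂₂ k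
  let V : ℕ → ℝ := fun j => E.v₁₁ (idx j)
  have hM : Monotone M := fun i j hij => add_le_add (E.v₂₁_mono (hidx hij)) le_rfl
  have hV : Monotone V := fun i j hij => E.v₁₁_strictMono.monotone (hidx hij)
  have hx0 : idx 0 = xs := by simpa using hidx' xs le_rfl
  have h0 : V 0 ≤ M 0 := by simpa [M, V, hx0] using hk
  refine ⟨fun a => share M V (a.val - xs.val), fun a => ?_, by simp [share], fun x a ha => ?_⟩
  · obtain ⟨h1, h2, -⟩ := share_nonneg_and hM hV h0 (a.val - xs.val)
    exact ⟨h1, h2⟩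
  · have hv : E.v₁₁ x = V ((max x xs).val - xs.val) ∨
        (max x xs).val - xs.val = 0 ∧ E.v₁₁ x ≤ V 0 := by
      rcases le_total xs x with hx | hx
      · left
        simp only [V, max_eq_left hx, hidx' x hx]
      · right
        simpa [max_eq_right hx, V, hx0] using E.v₁₁_strictMono.monotone hx
    have := share_optimal hM hV h0 _ hv (a.val - xs.val)
    simpa only [M, hidx' a ha, hidx' (max x xs) (le_max_right _ _)] using this

end

/-! ### The separating menu -/

section

variable {n m : ℕ} (E : Environment n m)

/-- The payoff of seller type `x` in the separating menu of size `ε` when every increment `k` is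
bought by the buyer types above `k`. -/
noncomputable def separatingPayoff (xs : Fin n) (w : Fin m → ℝ) (L ε : ℝ) (x : Fin n) : ℝ :=
  E.keepPayoff x + ε * ((L ^ 2 - E.v₁₁ xs ^ 2) / 2 - L ^ 2) -
    ε * (L - E.v₁₁ xs) * E.keepPayoff x +
    ∑ k, w k * (1 + ε ^ 2) * (margin E xs x k - ε ^ 2 * tail E k)

/-- The separating menu: seller types report through a scoring rule of size `ε`, and prices and
quantities of the increments move with the report so that the buyer's incentives do not. -/
theorem upsets_separating {xs : Fin n} (hcase : (∀ y, E.v₁₂ y = 0) ∨ ∀ x, x ≤ xs) {w : Fin m → ℝ}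
    (hw : ∀ k, 0 ≤ w k) (hw1 : ∑ k, w k ≤ 1) (hm : ∀ k, 0 < w k → 0 ≤ margin E xs xs k)
    {u : Fin n → ℝ} {L K ε : ℝ} (hε : 0 < ε) (hL0 : 0 < L) (hL : ∀ a, |E.v₁₁ a| ≤ L)
    (hK : ∀ a b, E.v₂₁ a - E.v₂₁ b ≤ K) {ϑ : Fin m → Fin n → ℝ}
    (hϑ : ∀ k a, ϑ k a ∈ Set.Icc (0 : ℝ) 1) (hϑ1 : ∀ k, ϑ k xs = 1)
    (hϑic : ∀ k, 0 < w k → ∀ x a, xs ≤ a → ϑ k a * (E.v₂₁ a + E.v₂₂ k - E.v₁₁ x) ≤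
      ϑ k (max x xs) * (E.v₂₁ (max x xs) + E.v₂₂ k - E.v₁₁ x))
    (hsize : ε * (2 * L) + (1 + ε ^ 2) * ∑ k, w k ≤ 1)
    (hgap : ∀ y k, y < k → ε ^ 2 < E.v₂₂ k - E.v₂₂ y)
    (hlowgap : ∀ x, x < xs → ε ^ 2 ≤ E.v₁₁ xs - E.v₁₁ x)
    (hscore : ∀ x a, xs ≤ a → a ≠ max x xs → ε ^ 2 * (K + 1) <
      ε / 2 * ((E.v₁₁ a - E.v₁₁ x) ^ 2 - (E.v₁₁ (max x xs) - E.v₁₁ x) ^ 2))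
    (hu : u xs < separatingPayoff E xs w L ε xs)
    (hlow : ∀ x, x < xs → separatingPayoff E xs w L ε x < u x) :
    ∃ G, Upsets E u xs G := by
  let A : Type := {a : Fin n // xs ≤ a}
  have : Nonempty A := ⟨⟨xs, le_rfl⟩⟩
  -- When the buyer's type does not affect the seller's value, `H a - h a * E.v₁₁ x` is a term free
  -- of `a` minus `ε / 2 * (E.v₁₁ a - E.v₁₁ x) ^ 2`: a proper quadratic score. The constants in `L`
  -- make `h` nonnegative and `H` negative.
  let h : A → ℝ := fun a => ε * (L - E.v₁₁ a.1)
  let H : A → ℝ := fun a => ε * ((L ^ 2 - E.v₁₁ a.1 ^ 2) / 2 - L ^ 2)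
  -- The added `ε ^ 2` keeps offered increments positive even where the share vanishes, and the
  -- discount `ε ^ 2` in `c` breaks the buyer's ties. Both distort reporting only at second order,
  -- which the first-order score dominates.
  let θ : A → Fin m → ℝ := fun a k => w k * (ϑ k a.1 + ε ^ 2)
  let c : A → Fin m → ℝ := fun a k => E.v₂₁ a.1 + E.v₂₂ k - ε ^ 2
  let r : A → Fin m → ℝ := fun a k => θ a k * c a k
  have hL1 : ∀ a, -L ≤ E.v₁₁ a ∧ E.v₁₁ a ≤ L := fun a => abs_le.1 (hL a)
  have h0 : ∀ a, 0 ≤ h a := fun a => mul_nonneg hε.le (by linarith [(hL1 a.1).2])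
  have hθpos : ∀ a k, 0 < w k → 0 < θ a k := fun a k hk =>
    mul_pos hk (by have := (hϑ k a.1).1; positivity)
  have hθ : ∀ a k, 0 ≤ θ a k := fun a k =>
    mul_nonneg (hw k) (by have := (hϑ k a.1).1; positivity)
  have h1 : ∀ a, h a + ∑ k, θ a k ≤ 1 := by
    intro a
    refine le_trans (add_le_add ?_ ?_) hsize
    · exact mul_le_mul_of_nonneg_left (by linarith [(hL1 a.1).1]) hε.le
    · rw [mul_sum]
      refine sum_le_sum fun k _ => ?_
      rw [mul_comm (1 + ε ^ 2)]
      exact mul_le_mul_of_nonneg_left (by linarith [(hϑ k a.1).2]) (hw k)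
  have hbase : ∀ x y a, 0 < (E.v₂₁ x + E.v₂₂ y) * h a - H a := by
    intro x y a
    have h2 := mul_nonneg (E.v₂_nonneg x y) (h0 a)
    have h3 : 0 < ε * ((L ^ 2 + E.v₁₁ a.1 ^ 2) / 2) := by positivity
    have h4 : H a = -(ε * ((L ^ 2 + E.v₁₁ a.1 ^ 2) / 2)) := by simp only [H]; ring
    linarith
  let α : Fin n → A := fun x => ⟨max x xs, le_max_right _ _⟩
  have hdom : ∀ β : Fin m → Fin m → ℝ, (∀ y k, β y k ∈ Set.Icc (0 : ℝ) 1) → ∀ x a, a ≠ α x →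
      menuValue E h H θ r β x a < menuValue E h H θ r β x (α x) := by
    intro β hβ x a ha
    have ha' : a.1 ≠ max x xs := fun he => ha (Subtype.ext he)
    rcases hcase with hv | htop
    swap
    · exact absurd ((le_antisymm (htop a.1) a.2).trans (max_eq_right (htop x)).symm) ha'
    rw [menuValue_eq E (c := c a) (fun k => rfl), menuValue_eq E (c := c (α x)) (fun k => rfl)]
    have hkeep : E.keepPayoff x = E.v₁₁ x := by
      simp [Environment.keepPayoff, hv, ← sum_mul, E.p₂_sum]
    let B : Fin m → ℝ := fun k => ∑ y, E.p₂ y * β y k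
    have hB0 : ∀ k, 0 ≤ B k := fun k => sum_nonneg fun y _ => mul_nonneg (E.p₂_pos y).le (hβ y k).1
    have hB1 : ∀ k, B k ≤ 1 := fun k => by
      rw [← E.p₂_sum]
      exact sum_le_sum fun y _ => mul_le_of_le_one_right (E.p₂_pos y).le (hβ y k).2
    have hfac : ∀ b k, ∑ y, E.p₂ y * (β y k * (c b k - (E.v₁₁ x + E.v₁₂ y))) =
        B k * (c b k - E.v₁₁ x) := by
      intro b k
      simp only [B, sum_mul, hv, add_zero, mul_assoc]
    simp only [hfac, hkeep]
    have hK0 : 0 ≤ K := by simpa using hK x x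
    have hk : ∀ k, θ a k * (B k * (c a k - E.v₁₁ x)) ≤
        θ (α x) k * (B k * (c (α x) k - E.v₁₁ x)) + w k * (ε ^ 2 * (K + 1)) := by
      intro k
      rcases (hw k).eq_or_lt with hz | hpos
      · simp [θ, ← hz]
      have h2 := hϑic k hpos x a.1 a.2
      have h3 : (ϑ k a.1 + ε ^ 2) * (c a k - E.v₁₁ x) ≤
          (ϑ k (max x xs) + ε ^ 2) * (c (α x) k - E.v₁₁ x) + ε ^ 2 * (K + 1) := by
        have h4 := hK a.1 (max x xs)
        have h5 := (hϑ k a.1).1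
        have h6 := (hϑ k (max x xs)).2
        have h7 : 0 ≤ ε ^ 2 * (1 - ϑ k (max x xs) + ϑ k a.1 +
            (K - (E.v₂₁ a.1 - E.v₂₁ (max x xs)))) :=
          mul_nonneg (sq_nonneg _) (by linarith)
        simp only [c, α]
        nlinarith
      have h4 := mul_le_mul_of_nonneg_left h3 (mul_nonneg hpos.le (hB0 k))
      have h5 : w k * B k * (ε ^ 2 * (K + 1)) ≤ w k * (ε ^ 2 * (K + 1)) :=
        mul_le_mul_of_nonneg_right (mul_le_of_le_one_right hpos.le (hB1 k)) (by positivity)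
      simp only [θ, α] at h4 ⊢
      nlinarith
    have hsum := sum_le_sum fun k (_ : k ∈ univ) => hk k
    rw [sum_add_distrib, ← sum_mul] at hsum
    have h2 : (∑ k, w k) * (ε ^ 2 * (K + 1)) ≤ ε ^ 2 * (K + 1) :=
      mul_le_of_le_one_left (by positivity) hw1
    have h3 := hscore x a.1 a.2 ha'
    have h4 : (H (α x) - h (α x) * E.v₁₁ x) - (H a - h a * E.v₁₁ x) =
        ε / 2 * ((E.v₁₁ a.1 - E.v₁₁ x) ^ 2 - (E.v₁₁ (max x xs) - E.v₁₁ x) ^ 2) := by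
      simp only [H, h, α]; ring
    linarith
  have hsur : ∀ π₁ : Fin n → ℝ, ∀ y k, menuSurplus E θ r α π₁ y k =
      ∑ x, π₁ x * (θ (α x) k * (E.v₂₁ x + E.v₂₂ y - c (α x) k)) := fun π₁ y k =>
    sum_congr rfl fun x _ => by simp only [r]; ring
  -- Types below `xs` report `xs`, so their price is at least the one matching their own type. Hence
  -- buyer types below `k` reject increment `k` under every belief.
  have hterm_neg : ∀ x y k, 0 < w k → y < k →
      θ (α x) k * (E.v₂₁ x + E.v₂₂ y - c (α x) k) < 0 := by
    intro x y k hk hyk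
    refine mul_neg_of_pos_of_neg (hθpos _ k hk) ?_
    have h2 := E.v₂₁_mono (le_max_left x xs)
    have h3 := hgap y k hyk
    simp only [c, α]
    linarith
  have hterm_pos : ∀ x y k, 0 < w k → xs ≤ x → k ≤ y →
      0 < θ (α x) k * (E.v₂₁ x + E.v₂₂ y - c (α x) k) := by
    intro x y k hk hx hyk
    refine mul_pos (hθpos _ k hk) ?_
    have h3 := E.v₂₂_strictMono.monotone hyk
    simp only [c, α, max_eq_left hx]
    linarith [pow_pos hε 2]
  have hsupp : ∀ π₁ ∈ stdSimplex ℝ (Fin n), ∃ x, 0 < π₁ x := by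
    intro π₁ hπ
    obtain ⟨x, -, hx⟩ : ∃ x ∈ (univ : Finset (Fin n)), π₁ x ≠ 0 :=
      exists_ne_zero_of_sum_ne_zero (by rw [hπ.2]; exact one_ne_zero)
    exact ⟨x, lt_of_le_of_ne (hπ.1 x) (Ne.symm hx)⟩
  have hαlow : ∀ x, x ≤ xs → α x = ⟨xs, le_rfl⟩ := fun x hx => Subtype.ext (max_eq_right hx)
  have hsplit : ∀ x k, ∑ y ∈ Ici k, E.p₂ y * (c ⟨xs, le_rfl⟩ k - (E.v₁₁ x + E.v₁₂ y)) =
      margin E xs x k - ε ^ 2 * tail E k := by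
    intro x k
    simp only [margin, tail, mul_sum, ← sum_sub_distrib]
    exact sum_congr rfl fun y _ => by simp only [c]; ring
  have hvalue : ∀ β : Fin m → Fin m → ℝ, ∀ x, x ≤ xs → menuValue E h H θ r β x (α x) =
      E.keepPayoff x + ε * ((L ^ 2 - E.v₁₁ xs ^ 2) / 2 - L ^ 2) -
        ε * (L - E.v₁₁ xs) * E.keepPayoff x + ∑ k, w k * (1 + ε ^ 2) *
          ∑ y, E.p₂ y * (β y k * (c ⟨xs, le_rfl⟩ k - (E.v₁₁ x + E.v₁₂ y))) := by
    intro β x hx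
    rw [hαlow x hx, menuValue_eq E (c := c ⟨xs, le_rfl⟩) (fun k => rfl)]
    simp only [θ, hϑ1, h, H]
  have hrestrict : ∀ (β : Fin m → ℝ) k, (∀ y, y < k → β y = 0) → ∀ f : Fin m → ℝ,
      ∑ y, E.p₂ y * (β y * f y) = ∑ y ∈ Ici k, E.p₂ y * (β y * f y) := by
    intro β k hβ f
    refine (sum_subset (subset_univ _) fun y _ hy => ?_).symm
    rw [hβ y (not_le.1 fun hc => hy (mem_Ici.2 hc)), zero_mul, mul_zero]
  have hzero : ∀ π₁ ∈ stdSimplex ℝ (Fin n), ∀ y k, 0 < w k → y < k →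
      menuSurplus E θ r α π₁ y k < 0 := by
    intro π₁ hπ y k hk hyk
    obtain ⟨x, hx⟩ := hsupp π₁ hπ
    rw [hsur]
    exact sum_neg' (fun x _ => mul_nonpos_of_nonneg_of_nonpos (hπ.1 x) (hterm_neg x y k hk hyk).le)
      ⟨x, mem_univ _, mul_neg_of_pos_of_neg hx (hterm_neg x y k hk hyk)⟩
  refine ⟨menu h H θ r h0 hθ h1, ⟨fun π₁ hπ g hg x hx => ?_, fun π₁ hπ hπ0 g hg => ?_,
    fun π₁ hπ => menu_BR_nonempty hbase hdom hπ⟩⟩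
  · obtain ⟨β, hβ, hβ1, hβ0, hval⟩ := menu_outcome hbase hdom hπ hg
    rw [hval, hvalue β x hx.le]
    refine lt_of_le_of_lt ?_ (hlow x hx)
    refine add_le_add le_rfl (sum_le_sum fun k _ => ?_)
    rcases (hw k).eq_or_lt with hz | hpos
    · simp [← hz]
    refine mul_le_mul_of_nonneg_left ?_ (by positivity)
    rw [hrestrict (fun y => β y k) k fun y hy => hβ0 y k (hzero π₁ hπ y k hpos hy), ← hsplit,
      ← sub_nonneg, ← sum_sub_distrib]
    have hmono : ∀ y y', y ≤ y' → β y k ≤ β y' k := by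
      intro y y' hy
      rcases hy.eq_or_lt with rfl | hlt
      · rfl
      by_cases hz : menuSurplus E θ r α π₁ y k < 0
      · rw [hβ0 y k hz]; exact (hβ y' k).1
      · rw [hβ1 y' k ?_]
        · exact (hβ y k).2
        · refine lt_of_le_of_lt (not_lt.1 hz) ?_
          obtain ⟨x₀, hx₀⟩ := hsupp π₁ hπ
          have hlt' : ∀ x, θ (α x) k * (E.v₂₁ x + E.v₂₂ y - c (α x) k) <
              θ (α x) k * (E.v₂₁ x + E.v₂₂ y' - c (α x) k) := fun x =>
            mul_lt_mul_of_pos_left (by linarith [E.v₂₂_strictMono hlt]) (hθpos _ k hpos)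
          rw [hsur, hsur]
          exact sum_lt_sum (fun x _ => mul_le_mul_of_nonneg_left (hlt' x).le (hπ.1 x))
            ⟨x₀, mem_univ _, mul_lt_mul_of_pos_left (hlt' x₀) hx₀⟩
    -- Pessimism can remove buyers, but low buyer types leave first. For a seller below `xs` the
    -- full sale is profitable and its gain decreases in `y`, so the lost sales are worth a
    -- nonnegative amount.
    have hcheb := sum_mul_nonneg_of_antitone (Ici k) (p := E.p₂)
      (f := fun y => c ⟨xs, le_rfl⟩ k - (E.v₁₁ x + E.v₁₂ y)) (h := fun y => 1 - β y k)
      (fun y _ => (E.p₂_pos y).le)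
      (fun y _ y' _ hy => by have := E.v₁₂_mono hy; simp only; linarith)
      (fun y _ y' _ hy => by have := hmono y y' hy; simp only; linarith)
      (fun y _ => by linarith [(hβ y k).2])
      (by
        rw [hsplit, margin_eq]
        have h2 := hm k hpos
        have h3 := mul_nonneg (sub_nonneg.2 (hlowgap x hx)) (tail_pos E k).le
        nlinarith)
    refine hcheb.trans_eq (sum_congr rfl fun y _ => by ring)
  · obtain ⟨β, hβ, hβ1, hβ0, hval⟩ := menu_outcome hbase hdom hπ hg
    rw [hval, hvalue β xs le_rfl]
    refine lt_of_lt_of_le hu (add_le_add le_rfl (sum_le_sum fun k _ => ?_))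
    rcases (hw k).eq_or_lt with hz | hpos
    · simp [← hz]
    refine mul_le_mul_of_nonneg_left ?_ (by positivity)
    rw [hrestrict (fun y => β y k) k fun y hy => hβ0 y k (hzero π₁ hπ y k hpos hy), ← hsplit]
    refine sum_le_sum fun y hy => ?_
    rw [hβ1 y k ?_, one_mul]
    rw [hsur]
    obtain ⟨x₀, hx₀⟩ := hsupp π₁ hπ
    have hx₀' : xs ≤ x₀ := not_lt.1 fun hc => hx₀.ne' (hπ0 x₀ hc)
    refine sum_pos' (fun x _ => ?_)
      ⟨x₀, mem_univ _, mul_pos hx₀ (hterm_pos x₀ y k hpos hx₀' (mem_Ici.1 hy))⟩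
    rcases lt_or_ge x xs with hx | hx
    · rw [hπ0 x hx, zero_mul]
    · exact mul_nonneg (hπ.1 x) (hterm_pos x y k hpos hx (mem_Ici.1 hy)).le

end

/-! ### Choice of the perturbation and of the scale -/

section

variable {n m : ℕ} (E : Environment n m)

theorem eventually_lt_of_continuous {f : ℝ → ℝ} (hf : Continuous f) {a c : ℝ} (h : f a < c) :
    ∀ᶠ ε in 𝓝[>] a, f ε < c :=
  ((hf.tendsto a).mono_left nhdsWithin_le_nhds).eventually (gt_mem_nhds h)

theorem continuous_separatingPayoff (xs : Fin n) (w : Fin m → ℝ) (L : ℝ) (x : Fin n) :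
    Continuous fun ε => separatingPayoff E xs w L ε x := by
  unfold separatingPayoff
  fun_prop

theorem separatingPayoff_zero (xs : Fin n) (w : Fin m → ℝ) (L : ℝ) (x : Fin n) :
    separatingPayoff E xs w L 0 x = E.keepPayoff x + ∑ k, w k * margin E xs x k := by
  simp [separatingPayoff]

theorem exists_upsets_separating {xs : Fin n} (hcase : (∀ y, E.v₁₂ y = 0) ∨ ∀ x, x ≤ xs)
    {w : Fin m → ℝ} (hw : ∀ k, 0 ≤ w k) (hw1 : ∑ k, w k < 1)
    (hm : ∀ k, 0 < w k → 0 ≤ margin E xs xs k) {u : Fin n → ℝ}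
    (hu : u xs < E.keepPayoff xs + ∑ k, w k * margin E xs xs k)
    (hlow : ∀ x, x < xs → E.keepPayoff x + ∑ k, w k * margin E xs x k < u x) :
    ∃ G, Upsets E u xs G := by
  have hshare : ∀ k, ∃ ϑ : Fin n → ℝ, (∀ a, ϑ a ∈ Set.Icc (0 : ℝ) 1) ∧ ϑ xs = 1 ∧
      (0 < w k → ∀ x a, xs ≤ a → ϑ a * (E.v₂₁ a + E.v₂₂ k - E.v₁₁ x) ≤
        ϑ (max x xs) * (E.v₂₁ (max x xs) + E.v₂₂ k - E.v₁₁ x)) := by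
    intro k
    rcases hcase with hv | htop
    · by_cases hk : 0 < w k
      · have := valuation_le_of_margin_nonneg E (hm k hk)
        rw [hv, add_zero] at this
        obtain ⟨ϑ, h1, h2, h3⟩ := exists_shares E this
        exact ⟨ϑ, h1, h2, fun _ => h3⟩
      · exact ⟨fun _ => 1, fun _ => by simp, rfl, fun h => absurd h hk⟩
    · refine ⟨fun _ => 1, fun _ => by simp, rfl, fun _ x a ha => ?_⟩
      rw [max_eq_right (htop x), le_antisymm (htop a) ha]
  choose ϑ hϑ hϑ1 hϑic using hshare
  let L : ℝ := 1 + ∑ a, |E.v₁₁ a|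
  have hL : ∀ a, |E.v₁₁ a| ≤ L := fun a => by
    have := single_le_sum (f := fun a => |E.v₁₁ a|) (fun a _ => abs_nonneg _) (mem_univ a)
    simp only [L]; linarith
  have hL0 : 0 < L := by
    have := sum_nonneg fun a (_ : a ∈ univ) => abs_nonneg (E.v₁₁ a)
    simp only [L]; linarith
  let K : ℝ := 2 * ∑ a, |E.v₂₁ a|
  have hK : ∀ a b, E.v₂₁ a - E.v₂₁ b ≤ K := fun a b => by
    have h1 := single_le_sum (f := fun a => |E.v₂₁ a|) (fun a _ => abs_nonneg _) (mem_univ a)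
    have h2 := single_le_sum (f := fun a => |E.v₂₁ a|) (fun a _ => abs_nonneg _) (mem_univ b)
    have h3 := le_abs_self (E.v₂₁ a)
    have h4 := neg_abs_le (E.v₂₁ b)
    simp only [K]; linarith
  have e0 : ∀ᶠ ε in 𝓝[>] (0 : ℝ), 0 < ε := eventually_mem_nhdsWithin
  have e1 : ∀ᶠ ε in 𝓝[>] (0 : ℝ), ε * (2 * L) + (1 + ε ^ 2) * ∑ k, w k < 1 :=
    eventually_lt_of_continuous (by fun_prop) (by simpa using hw1)
  have e2 : ∀ᶠ ε in 𝓝[>] (0 : ℝ), ∀ y k, y < k → ε ^ 2 < E.v₂₂ k - E.v₂₂ y := by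
    refine eventually_all.2 fun y => eventually_all.2 fun k => eventually_imp_distrib_left.2
      fun hyk => eventually_lt_of_continuous (f := fun ε => ε ^ 2) (by fun_prop) ?_
    simpa using E.v₂₂_strictMono hyk
  have e3 : ∀ᶠ ε in 𝓝[>] (0 : ℝ), ∀ x, x < xs → ε ^ 2 < E.v₁₁ xs - E.v₁₁ x := by
    refine eventually_all.2 fun x => eventually_imp_distrib_left.2
      fun hx => eventually_lt_of_continuous (f := fun ε => ε ^ 2) (by fun_prop) ?_
    simpa using E.v₁₁_strictMono hx
  -- The score condition divided by `ε`; in this form it is strict in the limit.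
  have e4 : ∀ᶠ ε in 𝓝[>] (0 : ℝ), ∀ x a, xs ≤ a → a ≠ max x xs → ε * (K + 1) <
      1 / 2 * ((E.v₁₁ a - E.v₁₁ x) ^ 2 - (E.v₁₁ (max x xs) - E.v₁₁ x) ^ 2) := by
    refine eventually_all.2 fun x => eventually_all.2 fun a => eventually_imp_distrib_left.2
      fun ha => eventually_imp_distrib_left.2 fun hne =>
        eventually_lt_of_continuous (f := fun ε => ε * (K + 1)) (by fun_prop) ?_
    rw [zero_mul]
    rcases le_total xs x with hx | hx
    · rw [max_eq_left hx] at hne ⊢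
      have : E.v₁₁ a - E.v₁₁ x ≠ 0 := sub_ne_zero.2 (E.v₁₁_strictMono.injective.ne hne)
      have := pow_pos (abs_pos.2 this) 2
      rw [sq_abs] at this
      simp only [sub_self]
      linarith
    · rw [max_eq_right hx] at hne ⊢
      have h1 := E.v₁₁_strictMono (lt_of_le_of_ne ha hne.symm)
      have h2 := E.v₁₁_strictMono.monotone hx
      nlinarith
  have e5 : ∀ᶠ ε in 𝓝[>] (0 : ℝ), -separatingPayoff E xs w L ε xs < -u xs :=
    eventually_lt_of_continuous (continuous_separatingPayoff E xs w L xs).neg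
      (by rw [Pi.neg_apply, separatingPayoff_zero]; linarith)
  have e6 : ∀ᶠ ε in 𝓝[>] (0 : ℝ), ∀ x, x < xs → separatingPayoff E xs w L ε x < u x := by
    refine eventually_all.2 fun x => eventually_imp_distrib_left.2 fun hx =>
      eventually_lt_of_continuous (continuous_separatingPayoff E xs w L x) ?_
    rw [separatingPayoff_zero]
    exact hlow x hx
  obtain ⟨ε, h0, h1, h2, h3, h4, h5, h6⟩ :=
    (e0.and (e1.and (e2.and (e3.and (e4.and (e5.and e6)))))).exists
  refine upsets_separating E hcase hw hw1.le hm h0 hL0 hL hK hϑ hϑ1 hϑic h1.le h2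
    (fun x hx => (h3 x hx).le) (fun x a ha hne => ?_) (neg_lt_neg_iff.1 h5) h6
  have := mul_lt_mul_of_pos_left (h4 x a ha hne) h0
  nlinarith

/-- If the price mixture `w`, offered by type `xs`, beats the payoff vector `u` for `xs`, and no lower
type gains from trading the same quantity at the payoff of `xs`, then some mechanism upsets `u`. -/
theorem exists_upsets (h : n = 2 ∨ ∀ y, E.v₁₂ y = 0) {xs : Fin n} {w : Fin m → ℝ}
    (hw : ∀ k, 0 ≤ w k) (hw1 : ∑ k, w k ≤ 1) {u : Fin n → ℝ} (hu0 : E.keepPayoff xs ≤ u xs)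
    (hu : u xs < E.keepPayoff xs + ∑ k, w k * margin E xs xs k)
    (hlow : ∀ x, x < xs → u xs - E.keepPayoff xs +
      (E.v₁₁ xs - E.v₁₁ x) * ∑ k, w k * tail E k ≤ u x - E.keepPayoff x) :
    ∃ G, Upsets E u xs G := by
  -- Dropping prices with negative margin raises the payoff of `xs` and only reduces the quantity,
  -- so imitation stays unattractive.
  let w' : Fin m → ℝ := fun k => if 0 ≤ margin E xs xs k then w k else 0
  have hw'0 : ∀ k, 0 ≤ w' k := fun k => by simp only [w']; split_ifs <;> simp [hw k]
  have hw'w : ∀ k, w' k ≤ w k := fun k => by simp only [w']; split_ifs <;> simp [hw k]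
  have hw'm : ∀ k, 0 < w' k → 0 ≤ margin E xs xs k := fun k hk => by
    by_contra hc
    simp [w', hc] at hk
  set R := ∑ k, w' k * margin E xs xs k with hR
  set Q := ∑ k, w' k * tail E k with hQ
  set N := u xs - E.keepPayoff xs with hN
  have hN0 : 0 ≤ N := sub_nonneg.2 hu0
  have hRN : N < R := by
    have : ∑ k, w k * margin E xs xs k ≤ R := by
      refine sum_le_sum fun k _ => ?_
      simp only [w']
      split_ifs with hk
      · rfl
      · rw [zero_mul]
        exact mul_nonpos_of_nonneg_of_nonpos (hw k) (not_le.1 hk).le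
    linarith
  have hQw : Q ≤ ∑ k, w k * tail E k :=
    sum_le_sum fun k _ => mul_le_mul_of_nonneg_right (hw'w k) (tail_pos E k).le
  have hQ0 : 0 < Q := by
    obtain ⟨k, -, hk⟩ : ∃ k ∈ (univ : Finset (Fin m)), w' k * margin E xs xs k ≠ 0 :=
      exists_ne_zero_of_sum_ne_zero (by rw [← hR]; linarith)
    have hk' : 0 < w' k := lt_of_le_of_ne (hw'0 k) (Ne.symm (left_ne_zero_of_mul hk))
    exact sum_pos' (fun k _ => mul_nonneg (hw'0 k) (tail_pos E k).le)
      ⟨k, mem_univ _, mul_pos hk' (tail_pos E k)⟩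
  have hR0 : 0 < R := hN0.trans_lt hRN
  have hl0 : N / R < 1 := (div_lt_one hR0).2 hRN
  have e0 : ∀ᶠ l in 𝓝[>] (N / R), N / R < l := eventually_mem_nhdsWithin
  have e1 : ∀ᶠ l in 𝓝[>] (N / R), l < 1 :=
    eventually_lt_of_continuous (f := fun l => l) continuous_id hl0
  -- At `l = N / R` type `xs` just breaks even while the quantity is strictly below `Q`. Lower types
  -- value that quantity more, so their weak loss becomes strict, and it stays strict for `l`
  -- slightly larger.
  have e2 : ∀ᶠ l in 𝓝[>] (N / R), ∀ x, x < xs →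
      l * R + (E.v₁₁ xs - E.v₁₁ x) * (l * Q) < N + (E.v₁₁ xs - E.v₁₁ x) * Q := by
    refine eventually_all.2 fun x => eventually_imp_distrib_left.2 fun hx =>
      eventually_lt_of_continuous (by fun_prop) ?_
    rw [div_mul_cancel₀ _ hR0.ne']
    have := E.v₁₁_strictMono hx
    refine add_lt_add_of_le_of_lt le_rfl (mul_lt_mul_of_pos_left ?_ (by linarith))
    exact mul_lt_of_lt_one_left hQ0 hl0
  obtain ⟨l, h0, h1, h2⟩ := (e0.and (e1.and e2)).exists
  have hlpos : 0 < l := (div_nonneg hN0 hR0.le).trans_lt h0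
  have hlR : N < l * R := (div_lt_iff₀ hR0).1 h0
  have hsum : ∀ x, ∑ k, l * w' k * margin E xs x k =
      l * R + (E.v₁₁ xs - E.v₁₁ x) * (l * Q) := by
    intro x
    simp only [hR, hQ, mul_sum, ← sum_add_distrib]
    exact sum_congr rfl fun k _ => by rw [margin_eq E xs x k]; ring
  have hwl0 : ∀ k, 0 ≤ l * w' k := fun k => mul_nonneg hlpos.le (hw'0 k)
  have hwl1 : ∑ k, l * w' k < 1 := by
    rw [← mul_sum]
    have h3 : ∑ k, w' k ≤ 1 := (sum_le_sum fun k _ => hw'w k).trans hw1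
    nlinarith
  have hwlm : ∀ k, 0 < l * w' k → 0 ≤ margin E xs xs k := fun k hk =>
    hw'm k (pos_of_mul_pos_right hk hlpos.le)
  have hwlu : u xs < E.keepPayoff xs + ∑ k, l * w' k * margin E xs xs k := by
    rw [hsum]
    simp only [sub_self, zero_mul, add_zero]
    linarith
  have hsep : ((∀ y, E.v₁₂ y = 0) ∨ ∀ x, x ≤ xs) → ∃ G, Upsets E u xs G := by
    intro hcase
    refine exists_upsets_separating E hcase hwl0 hwl1 hwlm hwlu fun x hx => ?_
    rw [hsum]
    have h3 := h2 x hx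
    have h4 := hlow x hx
    have h5 := E.v₁₁_strictMono hx
    have h6 := mul_le_mul_of_nonneg_left hQw (sub_nonneg.2 h5.le)
    linarith
  rcases h with rfl | hv
  · by_cases hxs : xs = 1
    · refine hsep (Or.inr fun x => ?_)
      subst hxs
      exact Fin.le_last x
    · refine exists_upsets_bot E (fun x => ?_) hwl0 hwl1.le hwlm hwlu
      have : xs = 0 := by omega
      subst this
      exact Fin.zero_le x
  · exact hsep (Or.inl hv)

end

section

variable {n m : ℕ} (E : Environment n m)

/-! ### Comparison with safe allocations -/

/-- Expected revenue net of the part of the seller's valuation that depends on the buyer's type. -/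
noncomputable def netRevenue (g : Allocation n m) (x : Fin n) : ℝ :=
  ∑ y, E.p₂ y * (g.t x y - E.v₁₂ y * g.q x y)

/-- Expected quantity. -/
noncomputable def quantity (q : Fin m → ℝ) : ℝ := ∑ y, E.p₂ y * q y

theorem sellerReport_eq (g : Allocation n m) (x' x : Fin n) :
    E.sellerReport g x' x =
      E.keepPayoff x + netRevenue E g x' - E.v₁₁ x * quantity E (g.q x') := by
  simp only [Environment.sellerReport, Environment.keepPayoff, netRevenue, quantity, mul_sum,
    ← sum_add_distrib, ← sum_sub_distrib]
  exact sum_congr rfl fun y _ => by ring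

theorem sum_increment_mul_tail (q : Fin m → ℝ) :
    ∑ k, increment q k * tail E k = quantity E q := by
  unfold tail quantity
  rw [← sum_mul_sum_Iic]
  exact sum_congr rfl fun y _ => by rw [sum_increment]

/-- Summation by parts identifies the gain from the price lottery with net revenue at the maximal
payments, less the cost of the quantity sold. -/
theorem sum_increment_mul_margin (q : Fin m → ℝ) (xs x : Fin n) :
    ∑ k, increment q k * margin E xs x k =
      ∑ y, E.p₂ y * (∑ k ∈ Iic y, (E.v₂₁ xs + E.v₂₂ k) * increment q k - E.v₁₂ y * q y) -
        E.v₁₁ x * quantity E q := by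
  have h1 : ∑ k, increment q k * margin E xs x k =
      ∑ k, (E.v₂₁ xs + E.v₂₂ k) * increment q k * ∑ y ∈ Ici k, E.p₂ y -
        ∑ k, increment q k * ∑ y ∈ Ici k, E.p₂ y * (E.v₁₁ x + E.v₁₂ y) := by
    rw [← sum_sub_distrib]
    refine sum_congr rfl fun k _ => ?_
    simp only [margin, mul_sum, ← sum_sub_distrib]
    exact sum_congr rfl fun y _ => by ring
  rw [h1, ← sum_mul_sum_Iic, ← sum_mul_sum_Iic]
  simp only [sum_increment, quantity, mul_sum (s := (univ : Finset (Fin m))), ← sum_sub_distrib]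
  exact sum_congr rfl fun y _ => by ring

section main

variable {E} [MeasurableSpace Mechanism] {g : Allocation n m}

/-- No price mixture offered by type `x` beats an equilibrium allocation that passes the intuitive
criterion, unless lower types would imitate `x`. -/
theorem sum_margin_le (h : n = 2 ∨ ∀ y, E.v₁₂ y = 0) (hg : E.IsEquilibriumAllocation g)
    (hIC : E.PassesIntuitive g) {x : Fin n} {q : Fin m → ℝ} (hq : ∀ y, q y ∈ Set.Icc (0 : ℝ) 1)
    (hmono : Monotone q)
    (hlow : ∀ x', x' < x → E.sellerPayoff g x - E.keepPayoff x +
      (E.v₁₁ x - E.v₁₁ x') * quantity E q ≤ E.sellerPayoff g x' - E.keepPayoff x') :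
    ∑ k, increment q k * margin E x x k ≤ E.sellerPayoff g x - E.keepPayoff x := by
  by_contra hc
  push Not at hc
  obtain ⟨G, hG⟩ := exists_upsets E h (xs := x) (u := E.sellerPayoff g)
    (increment_nonneg (fun y => (hq y).1) hmono) (sum_increment_le_one fun y => (hq y).2)
    (hg.keepPayoff_le x) (by linarith) (by simpa only [sum_increment_mul_tail] using hlow)
  exact hG.not_passesIntuitive hIC

/-- Take a type that gains in `g'` while no lower type does. Lower types do not imitate it in `g'`,
so a fortiori not at its smaller equilibrium payoff, and `sum_margin_le` applies to its row. -/
theorem sellerPayoff_le_of_safe (h : n = 2 ∨ ∀ y, E.v₁₂ y = 0) (hg : E.IsEquilibriumAllocation g)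
    (hIC : E.PassesIntuitive g) {g' : Allocation n m} (hs : E.Safe g') (x : Fin n) :
    E.sellerPayoff g' x ≤ E.sellerPayoff g x := by
  induction x using WellFoundedLT.induction with
  | ind x ih =>
    obtain ⟨hbic, hic, hir⟩ := hs
    by_contra hc
    push Not at hc
    have hv : StrictMono fun y => E.v₂₁ x + E.v₂₂ y := fun y y' hy =>
      add_lt_add_of_le_of_lt le_rfl (E.v₂₂_strictMono hy)
    have hpay := payment_le_of_incentive (v := fun y => E.v₂₁ x + E.v₂₂ y) (hic x) (hir x)
    have hle := sum_margin_le h hg hIC (x := x) (g'.q_mem x) (monotone_of_incentive hv (hic x))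
      (fun x' hx' => by
        have h1 := hbic x' x
        have h2 := ih x' hx'
        have h3 : E.sellerPayoff g' x = _ := sellerReport_eq E g' x x
        rw [sellerReport_eq] at h1
        linarith)
    have h3 : E.sellerPayoff g' x = _ := sellerReport_eq E g' x x
    have h4 : netRevenue E g' x ≤ ∑ y, E.p₂ y *
        (∑ k ∈ Iic y, (E.v₂₁ x + E.v₂₂ k) * increment (g'.q x) k - E.v₁₂ y * g'.q x y) :=
      sum_le_sum fun y _ => mul_le_mul_of_nonneg_left (sub_le_sub_right (hpay y) _) (E.p₂_pos y).le
    rw [sum_increment_mul_margin] at hle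
    linarith

/-- An equilibrium allocation that passes the intuitive criterion is payoff equivalent to a safe
allocation. -/
theorem exists_safe_sellerPayoff_eq (h : n = 2 ∨ ∀ y, E.v₁₂ y = 0)
    (hg : E.IsEquilibriumAllocation g) (hIC : E.PassesIntuitive g) :
    ∃ gs : Allocation n m, E.Safe gs ∧ E.sellerPayoff gs = E.sellerPayoff g := by
  -- Separability lets averaging over seller types absorb `E.v₂₁` into the payment `τ`, leaving a
  -- one-dimensional screening problem with values `E.v₂₂`.
  let qh : Fin m → ℝ := fun y => ∑ x, E.p₁ x * g.q x y
  let τ : Fin m → ℝ := fun y => ∑ x, E.p₁ x * (g.t x y - E.v₂₁ x * g.q x y)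
  have hrep : ∀ y y', ∑ x, E.p₁ x * E.buyerReport g y' x y = E.v₂₂ y * qh y' - τ y' := by
    intro y y'
    simp only [qh, τ, Environment.buyerReport, mul_sum, ← sum_sub_distrib]
    exact sum_congr rfl fun x _ => by ring
  have hic : ∀ y y', E.v₂₂ y * qh y' - τ y' ≤ E.v₂₂ y * qh y - τ y := fun y y' => by
    rw [← hrep, ← hrep]; exact hg.buyer_incentive y y'
  have hir : ∀ y, 0 ≤ E.v₂₂ y * qh y - τ y := fun y => by
    rw [← hrep]; exact hg.buyer_rational y
  have hτ := payment_le_of_incentive hic hir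
  obtain ⟨q, hq, hrow, hcol, hmono⟩ := exists_monotone_rows E.p₁_pos E.p₂_pos g.q_mem
    (monotone_of_incentive E.v₂₂_strictMono hic)
  let gs : Allocation n m :=
    { q := q
      t := fun x y => ∑ k ∈ Iic y, (E.v₂₁ x + E.v₂₂ k) * increment (q x) k
      q_mem := hq }
  have hv : ∀ x, StrictMono fun y => E.v₂₁ x + E.v₂₂ y := fun x y y' hy =>
    add_lt_add_of_le_of_lt le_rfl (E.v₂₂_strictMono hy)
  have hQ : ∀ x, quantity E (gs.q x) = quantity E (g.q x) := hrow
  -- Rearranged rows keep their expected quantity, so the equilibrium's own incentive constraints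
  -- supply the no-imitation hypothesis.
  have hle : ∀ x, netRevenue E gs x ≤ netRevenue E g x := by
    intro x
    have h1 : E.sellerPayoff g x = _ := sellerReport_eq E g x x
    have h2 := sum_margin_le h hg hIC (x := x) (hq x) (hmono x) (fun x' hx' => by
      have h3 := hg.sellerBIC x' x
      have h4 : quantity E (q x) = quantity E (g.q x) := hQ x
      rw [sellerReport_eq] at h3
      rw [h4]
      linarith)
    have h4 : quantity E (q x) = quantity E (g.q x) := hQ x
    rw [sum_increment_mul_margin, h4] at h2
    change netRevenue E gs x - _ ≤ _ at h2
    linarith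
  have hgsum : ∑ x, E.p₁ x * netRevenue E g x = ∑ y, E.p₂ y * (τ y - E.v₁₂ y * qh y) +
      ∑ x, E.p₁ x * (E.v₂₁ x * quantity E (g.q x)) := by
    simp only [netRevenue, quantity, τ, qh, mul_sum, ← sum_sub_distrib]
    rw [sum_comm (s := (univ : Finset (Fin m))), ← sum_add_distrib]
    refine sum_congr rfl fun x _ => ?_
    rw [← sum_add_distrib]
    exact sum_congr rfl fun y _ => by ring
  have hgssum : ∑ x, E.p₁ x * netRevenue E gs x =
      ∑ y, E.p₂ y * (∑ k ∈ Iic y, E.v₂₂ k * increment qh k - E.v₁₂ y * qh y) +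
      ∑ x, E.p₁ x * (E.v₂₁ x * quantity E (q x)) := by
    have hqh : qh = fun y => ∑ x, E.p₁ x * q x y := funext fun y => (hcol y).symm
    have ht : ∀ x y, gs.t x y = E.v₂₁ x * q x y + ∑ k ∈ Iic y, E.v₂₂ k * increment (q x) k := by
      intro x y
      simp only [gs, add_mul, sum_add_distrib, ← mul_sum, sum_increment]
    have hinc : ∀ y, ∑ k ∈ Iic y, E.v₂₂ k * increment qh k =
        ∑ x, E.p₁ x * ∑ k ∈ Iic y, E.v₂₂ k * increment (q x) k := by
      intro y
      simp only [hqh, increment_sum, mul_sum]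
      rw [sum_comm]
      exact sum_congr rfl fun x _ => sum_congr rfl fun k _ => by ring
    simp only [netRevenue, ht, hinc]
    simp only [hqh, quantity, mul_sum (s := (univ : Finset (Fin m))),
      mul_sum (s := (univ : Finset (Fin n))), ← sum_sub_distrib]
    rw [sum_comm (s := (univ : Finset (Fin m))), ← sum_add_distrib]
    refine sum_congr rfl fun x _ => ?_
    rw [← sum_add_distrib]
    exact sum_congr rfl fun y _ => by simp only [gs]; ring
  -- In total, the `E.v₂₁` terms depend only on preserved row quantities and the rest only on `qh`,
  -- for which `gs` charges the maximal payments. With the row-wise reverse inequality every row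
  -- must agree.
  have hsumle : ∑ x, E.p₁ x * netRevenue E g x ≤ ∑ x, E.p₁ x * netRevenue E gs x := by
    rw [hgsum, hgssum]
    refine add_le_add (sum_le_sum fun y _ => mul_le_mul_of_nonneg_left
      (sub_le_sub_right (hτ y) _) (E.p₂_pos y).le) (sum_le_sum fun x _ => ?_)
    have h4 : quantity E (q x) = quantity E (g.q x) := hQ x
    rw [h4]
  have heq : ∀ x, netRevenue E gs x = netRevenue E g x := by
    intro x
    have h1 := (sum_eq_sum_iff_of_le fun x _ =>
      mul_le_mul_of_nonneg_left (hle x) (E.p₁_pos x).le).1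
      (le_antisymm (sum_le_sum fun x _ =>
        mul_le_mul_of_nonneg_left (hle x) (E.p₁_pos x).le) hsumle) x (mem_univ x)
    exact mul_left_cancel₀ (E.p₁_pos x).ne' h1
  have hreport : ∀ x' x, E.sellerReport gs x' x = E.sellerReport g x' x := fun x' x => by
    rw [sellerReport_eq, sellerReport_eq, heq, hQ]
  refine ⟨gs, ⟨fun x x' => ?_, fun x y y' => ?_, fun x y => ?_⟩, funext fun x => hreport x x⟩
  · have := hg.sellerBIC x x'
    unfold Environment.sellerPayoff at this ⊢
    rwa [hreport, hreport]
  · exact incentive_of_monotone (hv x) (fun y => (hq x y).1) (hmono x) y y'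
  · exact rational_of_monotone (hv x) (fun y => (hq x y).1) (hmono x) y

end main

end

end InformedSeller

/-! ### The theorem -/

theorem theorem3 {n m : ℕ} [MeasurableSpace InformedSeller.Mechanism]
    (E : InformedSeller.Environment n m)
    (h : n = 2 ∨ ∀ y, E.v₁₂ y = 0)
    (g : InformedSeller.Allocation n m)
    (hg : E.IsEquilibriumAllocation g)
    (hIC : E.PassesIntuitive g) :
    (∃ gs : InformedSeller.Allocation n m, E.IsRSW gs) ∧
      ∀ gs : InformedSeller.Allocation n m, E.IsRSW gs →
        E.sellerPayoff g = E.sellerPayoff gs := by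
  obtain ⟨gs, hsafe, heq⟩ := InformedSeller.exists_safe_sellerPayoff_eq h hg hIC
  refine ⟨⟨gs, hsafe, fun x g' hg' => ?_⟩, fun g' hg' => funext fun x => le_antisymm ?_ ?_⟩
  · rw [heq]
    exact InformedSeller.sellerPayoff_le_of_safe h hg hIC hg' x
  · rw [← heq]
    exact hg'.2 x gs hsafe
  · exact InformedSeller.sellerPayoff_le_of_safe h hg hIC hg'.1 x
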